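/- Let $X\in\mathbb{R}^{n\times p}$ have columns $X_1,\dots,X_p$, let $\beta\in\mathbb{R}^p$ have support $\mathcal S=\{j:\beta_j\neq0\}$ with $|\mathcal S|=k_0$, and let $y=X\beta+w$ with $w\sim\mathcal N(0,\sigma^2 I_n)$. For $J\subseteq\{1,\dots,p\}$ let $X_J$ be the submatrix of $X$ with columns indexed by $J$ and let $P_J$ be the orthogonal projection of $\mathbb{R}^n$ onto its column space. Orthogonal matching pursuit produces $\mathcal S_0=\emptyset$, $r^0=y$ and, for $k\ge1$, $\mathcal S_k=\mathcal S_{k-1}\cup\{t^k\}$ with $t^k\in\arg\max_{t}|X_t^Tr^{k-1}|$ (ties are resolved by a fixed rule depending only on $\mathcal S_{k-1}$ and the set of maximizers) and $r^k=(I_n-P_{\mathcal S_k})y$. Put $RR(k)=\|r^k\|_2/\|r^{k-1}\|_2$. Fix an integer $k_{\max}$ with $k_0<k_{\max}<n$ and $k_{\max}\le p$, and fix $0<\alpha<1$. Let $$\Gamma(k)=\sqrt{F^{-1}_{\frac{n-k}{2},\frac12}\Big(\frac{\alpha}{k_{\max}(p-k+1)}\Big)},$$ where $F_{a,b}$ is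 the distribution function of the Beta distribution with parameters $a,b$. Residual ratio thresholding (RRT) returns $\mathcal S_{RRT}=\mathcal S_{k_{RRT}}$ with $k_{RRT}=\max\{1\le k\le k_{\max}: RR(k)<\Gamma(k)\}$ (and $k_{RRT}=0$ if there is no such $k$). Assume that at least one of the following conditions holds: 1. (RIC) $\delta_{k_0+1}<1/\sqrt{k_0+1}$, where $\delta_j$ is the smallest $\delta$ such that $(1-\delta)\|b\|_2^2\le\|Xb\|_2^2\le(1+\delta)\|b\|_2^2$ for all $b\in\mathbb{R}^p$ with at most $j$ nonzero entries; 2. (MIC) the columns of $X$ have unit Euclidean norm and $\max_{j\ne k}|X_j^TX_k|<\frac{1}{2k_0-1}$; 3. (ERC) the columns of $X$ have unit Euclidean norm, those indexed by $\mathcal S$ are linearly independent, and $\max_{j\notin\mathcal S}\|X_{\mathcal S}^\dagger X_j\|_1<1$, where $X_{\mathcal S}^\dagger=(X_{\mathcal S}^TX_{\mathcal S})^{-1}X_{\mathcal S}^T$. Then the limit $\lim_{\sigma^2\to0}\mathbb{P}(\mathcal S_{RRT}\supsetneq\mathcal S)$ exists and $$\lim_{\sigma^2\to0}\mathbb{P}(\mathcal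 S_{RRT}\supsetneq\mathcal S)\ \ge\ \frac{\alpha}{k_{\max}(p-k_0)}.$$ Consequently RRT is not high-SNR consistent: $\mathbb{P}(\mathcal S_{RRT}\ne\mathcal S)$ does not tend to $0$ as $\sigma^2\to0$. -/

import Mathlib

open Filter Topology MeasureTheory ProbabilityTheory

noncomputable section

namespace RRT

/-- The `j`-th column of `X`, as a vector of Euclidean space. -/
def colVec {n p : ℕ} (X : Matrix (Fin n) (Fin p) ℝ) (j : Fin p) : EuclideanSpace ℝ (Fin n) :=
  WithLp.toLp 2 (X.col j)

/-- The column space of the submatrix of `X` with columns indexed by `J`. -/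
def colSpan {n p : ℕ} (X : Matrix (Fin n) (Fin p) ℝ) (J : Finset (Fin p)) :
    Submodule ℝ (EuclideanSpace ℝ (Fin n)) :=
  Submodule.span ℝ (colVec X '' (J : Set (Fin p)))

/-- The residual `(I - P_J) y`, where `P_J` is the orthogonal projection onto the column space of
the columns indexed by `J`. -/
def residual {n p : ℕ} (X : Matrix (Fin n) (Fin p) ℝ) (J : Finset (Fin p))
    (y : EuclideanSpace ℝ (Fin n)) : EuclideanSpace ℝ (Fin n) :=
  y - (colSpan X J).starProjection y

open Classical in
/-- The set of indices `t` at which `|X_tᵀ r|` is maximal. -/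
def maximizers {n p : ℕ} (X : Matrix (Fin n) (Fin p) ℝ) (r : EuclideanSpace ℝ (Fin n)) :
    Finset (Fin p) :=
  Finset.univ.filter fun t => ∀ s : Fin p, |inner ℝ (colVec X s) r| ≤ |inner ℝ (colVec X t) r|

/-- The support sequence of orthogonal matching pursuit:
`S_0 = ∅` and `S_{k+1} = S_k ∪ {t}` with `t ∈ argmax_t |X_tᵀ r^k|` and `r^k = (I - P_{S_k}) y`.
The function `pick` resolves ties: given the current support and the set of maximizers, it selects
one of the maximizers. -/
def ompSupport {n p : ℕ} (X : Matrix (Fin n) (Fin p) ℝ)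
    (pick : Finset (Fin p) → Finset (Fin p) → Fin p)
    (y : EuclideanSpace ℝ (Fin n)) : ℕ → Finset (Fin p)
  | 0 => ∅
  | k + 1 => insert
      (pick (ompSupport X pick y k) (maximizers X (residual X (ompSupport X pick y k) y)))
      (ompSupport X pick y k)

/-- The residual ratio `RR(k) = ‖r^k‖₂ / ‖r^{k-1}‖₂` (used for `k ≥ 1`). -/
def residualRatio {n p : ℕ} (X : Matrix (Fin n) (Fin p) ℝ)
    (pick : Finset (Fin p) → Finset (Fin p) → Fin p)
    (y : EuclideanSpace ℝ (Fin n)) (k : ℕ) : ℝ :=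
  ‖residual X (ompSupport X pick y k) y‖ / ‖residual X (ompSupport X pick y (k - 1)) y‖

/-- The inverse of the distribution function of the Beta distribution with parameters `a`, `b`
(the quantile function). -/
def betaInvCDF (a b z : ℝ) : ℝ :=
  sInf {x : ℝ | z ≤ cdf (betaMeasure a b) x}

/-- The threshold `Γ(k) = √(F⁻¹_{(n-k)/2, 1/2} (α / (k_max (p - k + 1))))`. -/
def rrtThreshold (n p kmax : ℕ) (α : ℝ) (k : ℕ) : ℝ :=
  Real.sqrt (betaInvCDF (((n : ℝ) - k) / 2) (1 / 2) (α / (kmax * ((p : ℝ) - k + 1))))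

open Classical in
/-- `k_RRT = max {k ∈ {1, …, k_max} : RR(k) < Γ(k)}`, and `0` if there is no such `k`. -/
def rrtIndex {n p : ℕ} (X : Matrix (Fin n) (Fin p) ℝ)
    (pick : Finset (Fin p) → Finset (Fin p) → Fin p)
    (kmax : ℕ) (α : ℝ) (y : EuclideanSpace ℝ (Fin n)) : ℕ :=
  ((Finset.Icc 1 kmax).filter fun k =>
    residualRatio X pick y k < rrtThreshold n p kmax α k).sup id

/-- The support estimate `S_RRT = S_{k_RRT}` of residual ratio thresholding. -/
def rrtSupport {n p : ℕ} (X : Matrix (Fin n) (Fin p) ℝ)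
    (pick : Finset (Fin p) → Finset (Fin p) → Fin p)
    (kmax : ℕ) (α : ℝ) (y : EuclideanSpace ℝ (Fin n)) : Finset (Fin p) :=
  ompSupport X pick y (rrtIndex X pick kmax α y)

open Classical in
/-- The support of a vector. -/
def supp {p : ℕ} (b : EuclideanSpace ℝ (Fin p)) : Finset (Fin p) :=
  Finset.univ.filter fun j => b j ≠ 0

/-- The product `X b` as a vector of Euclidean space. -/
def apply {n p : ℕ} (X : Matrix (Fin n) (Fin p) ℝ) (b : EuclideanSpace ℝ (Fin p)) :
    EuclideanSpace ℝ (Fin n) :=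
  WithLp.toLp 2 (X.mulVec b.ofLp)

/-- The law of the observation noise: `N(0, v I_n)`, where `v = σ²` is the noise variance. -/
def noise (n : ℕ) (v : ℝ) : Measure (EuclideanSpace ℝ (Fin n)) :=
  multivariateGaussian 0 (v • (1 : Matrix (Fin n) (Fin n) ℝ))

/-- The restricted isometry constant of order `j`: the smallest `δ` such that
`(1 - δ) ‖b‖² ≤ ‖X b‖² ≤ (1 + δ) ‖b‖²` for all `b` with at most `j` nonzero entries. -/
def ric {n p : ℕ} (X : Matrix (Fin n) (Fin p) ℝ) (j : ℕ) : ℝ :=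
  sInf {δ : ℝ | ∀ b : EuclideanSpace ℝ (Fin p), (supp b).card ≤ j →
    (1 - δ) * ‖b‖ ^ 2 ≤ ‖apply X b‖ ^ 2 ∧ ‖apply X b‖ ^ 2 ≤ (1 + δ) * ‖b‖ ^ 2}

/-- The mutual coherence `max_{j ≠ k} |X_jᵀ X_k|`. -/
def coherence {n p : ℕ} (X : Matrix (Fin n) (Fin p) ℝ) : ℝ :=
  sSup {x : ℝ | ∃ j k : Fin p, j ≠ k ∧ x = |inner ℝ (colVec X j) (colVec X k)|}

/-- All columns have unit Euclidean norm. -/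
def UnitColumns {n p : ℕ} (X : Matrix (Fin n) (Fin p) ℝ) : Prop :=
  ∀ j : Fin p, ‖colVec X j‖ = 1

/-- The submatrix of `X` with columns indexed by `J`. -/
def subCols {n p : ℕ} (X : Matrix (Fin n) (Fin p) ℝ) (J : Finset (Fin p)) :
    Matrix (Fin n) J ℝ :=
  X.submatrix id Subtype.val

/-- The pseudo-inverse `A† = (Aᵀ A)⁻¹ Aᵀ` of a matrix of full column rank. -/
def pinv {n : ℕ} {ι : Type} [Fintype ι] [DecidableEq ι] (A : Matrix (Fin n) ι ℝ) :
    Matrix ι (Fin n) ℝ :=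
  (A.transpose * A)⁻¹ * A.transpose

/-- The exact recovery condition for `S`: the columns indexed by `S` are linearly independent
(so that `X_S†` is defined) and `‖X_S† X_j‖₁ < 1` for all `j ∉ S`. -/
def ExactRecovery {n p : ℕ} (X : Matrix (Fin n) (Fin p) ℝ) (S : Finset (Fin p)) : Prop :=
  LinearIndependent ℝ (fun i : S => colVec X i) ∧
    ∀ j : Fin p, j ∉ S → ∑ i : S, |((pinv (subCols X S)).mulVec (X.col j)) i| < 1

/-- High-SNR consistency of a support estimator `est` (a function of the observation) in the model
`y = X β + w`, `w ~ N(0, σ² I_n)`: the probability of a support recovery error tends to `0` as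
`σ² → 0`. -/
def HighSNRConsistent {n p : ℕ} (X : Matrix (Fin n) (Fin p) ℝ) (β : EuclideanSpace ℝ (Fin p))
    (est : EuclideanSpace ℝ (Fin n) → Finset (Fin p)) : Prop :=
  Tendsto (fun v : ℝ => (noise n v).real {w | est (apply X β + w) ≠ supp β}) (𝓝[>] 0) (𝓝 0)

end RRT

end

/-! Write `S` for the support of `β` and `k₀` for its size. Each of the three conditions yields
`Dominates X S` and keeps the columns outside `S` off the span of those in `S` (`dominates_of_ric`,
`dominates_of_coherence`, `dominates_of_exactRecovery`). While the current support is a proper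
subset of `S`, the noiseless residual is `X x` for a nonzero `x` supported in `S`. The greedy choice
therefore falls on a new index of `S`, and still does under small noise, so the support after `k₀`
steps is exactly `S`.

From then on the signal is projected out and residuals are linear in the noise. With noise `√v • z`
and `z` standard Gaussian, the scale `√v` affects neither argmaxima nor residual ratios after step
`k₀`. For each fixed `z`, whether overestimation occurs is thus eventually constant as `v → 0`, and
the limit exists by convergence of indicators.

For the lower bound it suffices that `RR(k₀ + 1) < Γ(k₀ + 1)`. The column selected at that step is
random, so compare it with a fixed column `j` whose residual modulo the span of `S` has the largest
norm. The greedy column has at least the correlation of `j` and at most its residual norm, hence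
shrinks the residual at least as much. For the fixed direction of `j` the squared ratio is Beta with
parameters `(n - k₀ - 1) / 2` and `1 / 2` (`map_residual_ratio_stdGaussian`), so it lies below the
quantile `Γ(k₀ + 1) ^ 2` with probability at least the level of that quantile
(`le_stdGaussian_ratio_lt`). -/

namespace RRT

/-! ### Design conditions that make the support columns dominate -/

section LinearAlgebra

variable {n p : ℕ} {X : Matrix (Fin n) (Fin p) ℝ}

lemma mem_supp {b : EuclideanSpace ℝ (Fin p)} {j : Fin p} : j ∈ supp b ↔ b j ≠ 0 := by
  simp [supp]

lemma apply_eq_zero_of_supp_subset {b : EuclideanSpace ℝ (Fin p)} {S : Finset (Fin p)}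
    (hb : supp b ⊆ S) {j : Fin p} (hj : j ∉ S) : b j = 0 := by
  by_contra h
  exact hj (hb (mem_supp.2 h))

lemma apply_eq_sum (X : Matrix (Fin n) (Fin p) ℝ) (b : EuclideanSpace ℝ (Fin p)) :
    apply X b = ∑ j, b j • colVec X j := by
  ext i
  simp [apply, colVec, Matrix.mulVec, dotProduct, mul_comm]

lemma apply_eq_sum_of_supp_subset {b : EuclideanSpace ℝ (Fin p)} {S : Finset (Fin p)}
    (hb : supp b ⊆ S) : apply X b = ∑ j ∈ S, b j • colVec X j := by
  rw [apply_eq_sum]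
  refine (Finset.sum_subset (Finset.subset_univ S) fun j _ hj => ?_).symm
  rw [apply_eq_zero_of_supp_subset hb hj, zero_smul]

lemma apply_add (X : Matrix (Fin n) (Fin p) ℝ) (b c : EuclideanSpace ℝ (Fin p)) :
    apply X (b + c) = apply X b + apply X c := by
  simp [apply_eq_sum, add_smul, Finset.sum_add_distrib]

lemma apply_sub (X : Matrix (Fin n) (Fin p) ℝ) (b c : EuclideanSpace ℝ (Fin p)) :
    apply X (b - c) = apply X b - apply X c := by
  simp [apply_eq_sum, sub_smul, Finset.sum_sub_distrib]

lemma apply_smul (X : Matrix (Fin n) (Fin p) ℝ) (s : ℝ) (b : EuclideanSpace ℝ (Fin p)) :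
    apply X (s • b) = s • apply X b := by
  simp [apply_eq_sum, Finset.smul_sum, mul_smul]

lemma apply_single (X : Matrix (Fin n) (Fin p) ℝ) (j : Fin p) :
    apply X (EuclideanSpace.single j 1) = colVec X j := by
  simp [apply_eq_sum]

lemma colVec_mem_colSpan {J : Finset (Fin p)} {j : Fin p} (hj : j ∈ J) :
    colVec X j ∈ colSpan X J :=
  Submodule.subset_span ⟨j, hj, rfl⟩

lemma apply_mem_colSpan {b : EuclideanSpace ℝ (Fin p)} {S : Finset (Fin p)} (hb : supp b ⊆ S) :
    apply X b ∈ colSpan X S := by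
  rw [apply_eq_sum_of_supp_subset hb]
  exact Submodule.sum_mem _ fun j hj => Submodule.smul_mem _ _ (colVec_mem_colSpan hj)

lemma exists_extension (X : Matrix (Fin n) (Fin p) ℝ) {S : Finset (Fin p)} (c : S → ℝ) :
    ∃ x : EuclideanSpace ℝ (Fin p), supp x ⊆ S ∧ (∀ l : S, x l = c l) ∧
      apply X x = ∑ l : S, c l • colVec X l := by
  classical
  set x : EuclideanSpace ℝ (Fin p) :=
    WithLp.toLp 2 fun l => if h : l ∈ S then c ⟨l, h⟩ else 0 with hx
  have hxS : supp x ⊆ S := fun l hl => by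
    by_contra h
    exact mem_supp.1 hl (by simp [hx, h])
  refine ⟨x, hxS, fun l => by simp [hx], ?_⟩
  rw [apply_eq_sum_of_supp_subset hxS, ← Finset.sum_coe_sort]
  exact Finset.sum_congr rfl fun l _ => by simp [hx]

lemma exists_apply_eq_of_mem_colSpan {S : Finset (Fin p)} {v : EuclideanSpace ℝ (Fin n)}
    (hv : v ∈ colSpan X S) : ∃ b, supp b ⊆ S ∧ apply X b = v := by
  obtain ⟨c, hc⟩ := (Submodule.mem_span_image_finset_iff_exists_fun ℝ).1 hv
  obtain ⟨x, hxS, -, hx⟩ := exists_extension X c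
  exact ⟨x, hxS, hx.trans hc⟩

lemma colSpan_mono {J S : Finset (Fin p)} (h : J ⊆ S) : colSpan X J ≤ colSpan X S :=
  Submodule.span_mono (Set.image_mono (by exact_mod_cast h))

lemma supp_smul_add_smul_single_subset {x : EuclideanSpace ℝ (Fin p)} {S : Finset (Fin p)}
    (hx : supp x ⊆ S) (s t : ℝ) (j : Fin p) :
    supp (s • x + t • EuclideanSpace.single j (1 : ℝ)) ⊆ insert j S := by
  intro i hi
  by_contra h
  rw [Finset.mem_insert, not_or] at h
  exact mem_supp.1 hi (by simp [apply_eq_zero_of_supp_subset hx h.2, h.1])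

/-- Every noiseless signal supported in `S` correlates with some column indexed by `S` more than
with a given column outside of `S`. -/
def Dominates (X : Matrix (Fin n) (Fin p) ℝ) (S : Finset (Fin p)) : Prop :=
  ∀ x : EuclideanSpace ℝ (Fin p), x ≠ 0 → supp x ⊆ S → ∀ j ∉ S, ∃ i ∈ S,
    |inner ℝ (colVec X j) (apply X x)| < |inner ℝ (colVec X i) (apply X x)|

lemma notMem_colSpan_of_apply_ne_zero {S : Finset (Fin p)} {j : Fin p} (hj : j ∉ S)
    (h : ∀ x : EuclideanSpace ℝ (Fin p), x ≠ 0 → supp x ⊆ insert j S → apply X x ≠ 0) :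
    colVec X j ∉ colSpan X S := by
  intro hmem
  obtain ⟨c, hc, hcj⟩ := exists_apply_eq_of_mem_colSpan hmem
  refine h ((-1 : ℝ) • c + (1 : ℝ) • EuclideanSpace.single j 1) (fun h0 => ?_)
    (supp_smul_add_smul_single_subset hc _ _ j) ?_
  · have := congrArg (fun v : EuclideanSpace ℝ (Fin p) => v j) h0
    simp [apply_eq_zero_of_supp_subset hc hj] at this
  · rw [apply_add, apply_smul, apply_smul, apply_single, hcj]
    simp

/-! ### Restricted isometry -/

/-- Since `ric` is an infimum, a value below `D` produces an admissible constant below `D` once some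
constant is admissible; a crude operator bound supplies one. -/
lemma exists_isometry_constant {j : ℕ} {D : ℝ} (hD : 0 < D) (h : ric X j < D) :
    ∃ δ, 0 < δ ∧ δ < D ∧ ∀ b : EuclideanSpace ℝ (Fin p), (supp b).card ≤ j →
      (1 - δ) * ‖b‖ ^ 2 ≤ ‖apply X b‖ ^ 2 ∧ ‖apply X b‖ ^ 2 ≤ (1 + δ) * ‖b‖ ^ 2 := by
  have hne : {δ : ℝ | ∀ b : EuclideanSpace ℝ (Fin p), (supp b).card ≤ j →
      (1 - δ) * ‖b‖ ^ 2 ≤ ‖apply X b‖ ^ 2 ∧ ‖apply X b‖ ^ 2 ≤ (1 + δ) * ‖b‖ ^ 2}.Nonempty := by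
    set C := ∑ j, ‖colVec X j‖
    refine ⟨1 + C ^ 2, fun b _ => ⟨?_, ?_⟩⟩
    · nlinarith [sq_nonneg ‖apply X b‖, mul_nonneg (sq_nonneg C) (sq_nonneg ‖b‖)]
    · have h1 : ‖apply X b‖ ≤ C * ‖b‖ := by
        rw [apply_eq_sum, Finset.sum_mul]
        refine (norm_sum_le _ _).trans (Finset.sum_le_sum fun i _ => ?_)
        rw [norm_smul, mul_comm]
        gcongr
        exact PiLp.norm_apply_le b i
      have h2 := pow_le_pow_left₀ (norm_nonneg _) h1 2
      nlinarith [sq_nonneg ‖b‖]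
  obtain ⟨δ, hδ, hδD⟩ := exists_lt_of_csInf_lt hne h
  -- Enlarging `δ` weakens both inequalities, and `D / 2` makes it positive, as the later
  -- cancellation of `δ` requires.
  refine ⟨max δ (D / 2), lt_max_of_lt_right (by linarith), max_lt hδD (by linarith), fun b hb => ?_⟩
  obtain ⟨h1, h2⟩ := hδ b hb
  have := le_max_left δ (D / 2)
  constructor
  · refine le_trans ?_ h1
    gcongr
  · refine h2.trans ?_
    gcongr

/-- On the plane spanned by `x` and `e_j`, the compression of `XᵀX - I` has operator norm at most
`δ`; the conclusion bounds the image of `x`. Here `A = ‖X x‖²`, `N = ‖x‖²`, `B = ⟨X_j, X x⟩` and `C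
= ‖X_j‖²`. -/
lemma sq_add_mul_sq_le_of_quadratic_form_le {A B C N δ : ℝ} (hδ : 0 < δ)
    (h : ∀ s t : ℝ, (1 - δ) * (s ^ 2 * N + t ^ 2) ≤ s ^ 2 * A + 2 * s * t * B + t ^ 2 * C ∧
      s ^ 2 * A + 2 * s * t * B + t ^ 2 * C ≤ (1 + δ) * (s ^ 2 * N + t ^ 2)) :
    (A - N) ^ 2 + N * B ^ 2 ≤ δ ^ 2 * N ^ 2 := by
  have h1 := discrim_le_zero (a := δ * N + (A - N)) (b := 2 * B) (c := δ + (C - 1))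
    fun s => by nlinarith [(h s 1).1]
  have h2 := discrim_le_zero (a := δ * N - (A - N)) (b := -2 * B) (c := δ - (C - 1))
    fun s => by nlinarith [(h s 1).2]
  have p1 : 0 ≤ δ * N + (A - N) := by nlinarith [(h 1 0).1]
  have p2 : 0 ≤ δ * N - (A - N) := by nlinarith [(h 1 0).2]
  unfold discrim at h1 h2
  have q1 : B ^ 2 ≤ (δ * N + (A - N)) * (δ + (C - 1)) := by linarith
  have q2 : B ^ 2 ≤ (δ * N - (A - N)) * (δ - (C - 1)) := by linarith
  -- Cross-weighting the two discriminant bounds eliminates `C`, which is not assumed to be `1`.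
  have m1 := mul_le_mul_of_nonneg_left q1 p2
  have m2 := mul_le_mul_of_nonneg_left q2 p1
  have : δ * ((A - N) ^ 2 + N * B ^ 2) ≤ δ * (δ ^ 2 * N ^ 2) := by nlinarith
  exact le_of_mul_le_mul_left this hδ

/-- If no column of `S` beats `X_j`, then `‖X x‖² = ∑ x_i ⟨X_i, X x⟩ ≤ |B| ‖x‖₁`, so `A² ≤ K N B²`
with `K` the size of `S`. With the quadratic form bound this gives `(A - N)² + A² / K ≤ δ² N²`,
whose left side is at least `N² / (K + 1)`. -/
lemma dominates_of_ric {S : Finset (Fin p)} (h : ric X (S.card + 1) < 1 / √((S.card : ℝ) + 1)) :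
    Dominates X S ∧ ∀ j ∉ S, colVec X j ∉ colSpan X S := by
  have hK : (0 : ℝ) < (S.card : ℝ) + 1 := by positivity
  obtain ⟨δ, hδ, hδD, hX⟩ := exists_isometry_constant (by positivity) h
  have hδ2 : δ ^ 2 * ((S.card : ℝ) + 1) < 1 := by
    have := pow_lt_pow_left₀ hδD hδ.le two_ne_zero
    rw [div_pow, Real.sq_sqrt hK.le, one_pow, lt_div_iff₀ hK] at this
    exact this
  refine ⟨fun x hx hxS j hj => ?_, fun j hj => notMem_colSpan_of_apply_ne_zero hj
    fun x hx hxS h0 => ?_⟩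
  · by_contra! hcon
    set r := apply X x
    set B := inner ℝ (colVec X j) r
    have hN : 0 < ‖x‖ := norm_pos_iff.2 hx
    have hquad : ∀ s t : ℝ, (1 - δ) * (s ^ 2 * ‖x‖ ^ 2 + t ^ 2) ≤
        s ^ 2 * ‖r‖ ^ 2 + 2 * s * t * B + t ^ 2 * ‖colVec X j‖ ^ 2 ∧
        s ^ 2 * ‖r‖ ^ 2 + 2 * s * t * B + t ^ 2 * ‖colVec X j‖ ^ 2 ≤
          (1 + δ) * (s ^ 2 * ‖x‖ ^ 2 + t ^ 2) := by
      intro s t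
      have hc : (supp (s • x + t • EuclideanSpace.single j (1 : ℝ))).card ≤ S.card + 1 :=
        (Finset.card_le_card (supp_smul_add_smul_single_subset hxS s t j)).trans
          (Finset.card_insert_le _ _)
      have e1 : ‖s • x + t • EuclideanSpace.single j (1 : ℝ)‖ ^ 2 = s ^ 2 * ‖x‖ ^ 2 + t ^ 2 := by
        rw [norm_add_sq_real, norm_smul, norm_smul, inner_smul_left, inner_smul_right,
          EuclideanSpace.inner_single_right, apply_eq_zero_of_supp_subset hxS hj, mul_pow, mul_pow]
        simp
      have e2 : ‖apply X (s • x + t • EuclideanSpace.single j (1 : ℝ))‖ ^ 2 =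
          s ^ 2 * ‖r‖ ^ 2 + 2 * s * t * B + t ^ 2 * ‖colVec X j‖ ^ 2 := by
        rw [apply_add, apply_smul, apply_smul, apply_single, norm_add_sq_real, norm_smul,
          norm_smul, inner_smul_left, inner_smul_right, mul_pow, mul_pow, real_inner_comm]
        simp only [Real.norm_eq_abs, sq_abs, conj_trivial, B, r]
        ring
      have := hX _ hc
      rwa [e1, e2] at this
    have hmain := sq_add_mul_sq_le_of_quadratic_form_le hδ hquad
    have hA : ‖r‖ ^ 2 ≤ |B| * ∑ i ∈ S, |x i| := by
      rw [← real_inner_self_eq_norm_sq]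
      conv_lhs => enter [2]; rw [show r = _ from apply_eq_sum_of_supp_subset hxS]
      rw [sum_inner, Finset.mul_sum]
      refine Finset.sum_le_sum fun i hi => ?_
      rw [inner_smul_left, conj_trivial, mul_comm]
      refine (le_abs_self _).trans ?_
      rw [abs_mul]
      exact mul_le_mul_of_nonneg_right (hcon i hi) (abs_nonneg _)
    have hcs : (∑ i ∈ S, |x i|) ^ 2 ≤ S.card * ‖x‖ ^ 2 := by
      refine (sq_sum_le_card_mul_sum_sq).trans ?_
      gcongr
      rw [EuclideanSpace.real_norm_sq_eq]
      simp only [sq_abs]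
      exact Finset.sum_le_univ_sum_of_nonneg fun i => sq_nonneg _
    have hA2 : (‖r‖ ^ 2) ^ 2 ≤ B ^ 2 * (S.card * ‖x‖ ^ 2) := by
      refine (pow_le_pow_left₀ (sq_nonneg _) hA 2).trans ?_
      rw [mul_pow, sq_abs]
      gcongr
    set A := ‖r‖ ^ 2
    set N := ‖x‖ ^ 2
    set K := (S.card : ℝ)
    have hN' : 0 < N := by positivity
    have hK0 : 0 ≤ K := Nat.cast_nonneg _
    have hN2 : 0 < N ^ 2 := by positivity
    have l1 : K * (K + 1) * (A - N) ^ 2 + (K + 1) * A ^ 2 ≤ K * (K + 1) * (δ ^ 2 * N ^ 2) := by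
      have := mul_le_mul_of_nonneg_left hmain (by positivity : 0 ≤ K * (K + 1))
      have := mul_le_mul_of_nonneg_left hA2 hK.le
      nlinarith
    have hKpos : 0 < K := by
      rcases hK0.eq_or_lt with h0 | h0
      · have hS : S = ∅ := by
          have : (S.card : ℝ) = 0 := h0.symm
          simpa using this
        refine absurd ?_ hx
        ext i
        exact apply_eq_zero_of_supp_subset hxS (by simp [hS])
      · exact h0
    have l2 : K * (δ ^ 2 * (K + 1)) * N ^ 2 < K * 1 * N ^ 2 := by gcongr
    -- The left side of `l1` equals `((K + 1) A - K N)² + K N²`, which contradicts `l2`.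
    nlinarith [sq_nonneg ((K + 1) * A - K * N)]
  · have hc : (supp x).card ≤ S.card + 1 :=
      (Finset.card_le_card hxS).trans (Finset.card_insert_le _ _)
    have := (hX x hc).1
    rw [h0] at this
    have hN : 0 < ‖x‖ ^ 2 := by
      have := norm_pos_iff.2 hx
      positivity
    have hδ1 : δ < 1 := by
      have : (0 : ℝ) ≤ S.card := Nat.cast_nonneg _
      nlinarith
    simp only [norm_zero] at this
    nlinarith

/-! ### Mutual incoherence -/

lemma abs_inner_colVec_le_coherence {j k : Fin p} (hjk : j ≠ k) :
    |inner ℝ (colVec X j) (colVec X k)| ≤ coherence X := by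
  refine le_csSup (Set.Finite.bddAbove ?_) ⟨j, k, hjk, rfl⟩
  refine (Set.finite_range fun q : Fin p × Fin p =>
    |inner ℝ (colVec X q.1) (colVec X q.2)|).subset ?_
  rintro _ ⟨j, k, _, rfl⟩
  exact ⟨(j, k), rfl⟩

lemma coherence_nonneg : 0 ≤ coherence X :=
  Real.sSup_nonneg (by rintro _ ⟨j, k, _, rfl⟩; exact abs_nonneg _)

lemma abs_inner_apply_le_coherence_mul {T : Finset (Fin p)} {x : EuclideanSpace ℝ (Fin p)} {M : ℝ}
    (hM : ∀ l, |x l| ≤ M) {j : Fin p} (hj : j ∉ T) :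
    |inner ℝ (colVec X j) (∑ l ∈ T, x l • colVec X l)| ≤ coherence X * T.card * M := by
  rw [inner_sum]
  refine (Finset.abs_sum_le_sum_abs _ _).trans ?_
  refine (Finset.sum_le_card_nsmul T _ (coherence X * M) fun l hl => ?_).trans_eq ?_
  · rw [inner_smul_right, abs_mul, mul_comm]
    exact mul_le_mul (abs_inner_colVec_le_coherence fun h => hj (h ▸ hl)) (hM l) (abs_nonneg _)
      coherence_nonneg
  · rw [nsmul_eq_mul]; ring

lemma le_abs_inner_apply (hX : UnitColumns X) {T : Finset (Fin p)} {x : EuclideanSpace ℝ (Fin p)}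
    (hxT : supp x ⊆ T) {i : Fin p} (hi : i ∈ T) (hmax : ∀ l, |x l| ≤ |x i|) :
    |x i| * (1 - coherence X * (T.card - 1)) ≤ |inner ℝ (colVec X i) (apply X x)| := by
  classical
  have h := abs_inner_apply_le_coherence_mul (X := X) hmax (Finset.notMem_erase i T)
  rw [Finset.card_erase_of_mem hi, Nat.cast_sub (Finset.card_pos.2 ⟨i, hi⟩), Nat.cast_one] at h
  rw [apply_eq_sum_of_supp_subset hxT, ← Finset.add_sum_erase T _ hi, inner_add_right,
    inner_smul_right, real_inner_self_eq_norm_sq, hX i, one_pow, mul_one]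
  have := abs_sub_abs_le_abs_sub (x i)
    (-inner ℝ (colVec X i) (∑ l ∈ T.erase i, x l • colVec X l))
  rw [abs_neg, sub_neg_eq_add] at this
  nlinarith

lemma exists_abs_apply_max {x : EuclideanSpace ℝ (Fin p)} (hx : x ≠ 0) :
    ∃ i ∈ supp x, ∀ l, |x l| ≤ |x i| := by
  have hne : (supp x).Nonempty := by
    by_contra h
    rw [Finset.not_nonempty_iff_eq_empty] at h
    refine hx ?_
    ext j
    exact apply_eq_zero_of_supp_subset (S := ∅) (by simp [h]) (by simp)
  obtain ⟨i, hi, hmax⟩ := Finset.exists_max_image (supp x) (fun l => |x l|) hne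
  refine ⟨i, hi, fun l => ?_⟩
  by_cases hl : l ∈ supp x
  · exact hmax l hl
  · rw [mem_supp, not_not] at hl
    simp [hl]

/-- Let `M` be the largest `|x_i|`, `k` the size of `S` and `μ` the coherence. At the maximal entry
the correlation is at least `M (1 - μ (k - 1))`; outside `S` it is at most `μ k M`. The condition `μ
(2k - 1) < 1` separates the two. -/
lemma dominates_of_coherence {S : Finset (Fin p)} (hX : UnitColumns X)
    (h : coherence X < 1 / (2 * (S.card : ℝ) - 1)) :
    Dominates X S ∧ ∀ j ∉ S, colVec X j ∉ colSpan X S := by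
  classical
  have hμ := coherence_nonneg (X := X)
  -- For empty `S` the bound would be `-1`, which a nonnegative coherence cannot beat.
  have hpos : (0 : ℝ) < 2 * S.card - 1 := one_div_pos.1 (hμ.trans_lt h)
  have hcard : (1 : ℝ) ≤ S.card := by
    have : (0 : ℝ) < S.card := by linarith
    exact_mod_cast this
  rw [lt_div_iff₀ hpos] at h
  refine ⟨fun x hx hxS j hj => ?_, fun j hj => notMem_colSpan_of_apply_ne_zero hj
    fun x hx hxS h0 => ?_⟩
  · obtain ⟨i, hi, hmax⟩ := exists_abs_apply_max hx
    refine ⟨i, hxS hi, ?_⟩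
    have h1 := le_abs_inner_apply hX hxS (hxS hi) hmax
    have h2 := abs_inner_apply_le_coherence_mul (X := X) hmax hj
    rw [← apply_eq_sum_of_supp_subset hxS] at h2
    have h3 : 0 < |x i| := abs_pos.2 (mem_supp.1 hi)
    refine lt_of_le_of_lt h2 (lt_of_lt_of_le ?_ h1)
    nlinarith [mul_lt_mul_of_pos_left h h3]
  · obtain ⟨i, hi, hmax⟩ := exists_abs_apply_max hx
    have h1 := le_abs_inner_apply hX hxS (hxS hi) hmax
    rw [h0, inner_zero_right, abs_zero, Finset.card_insert_of_notMem hj] at h1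
    have h3 : 0 < |x i| := abs_pos.2 (mem_supp.1 hi)
    push_cast at h1
    have h4 : coherence X * S.card < 1 := by nlinarith
    nlinarith

/-! ### Exact recovery -/

/-- These are the normal equations; independence of the columns makes the Gram matrix invertible, so
the matrix inverse in `pinv` is genuine. -/
lemma inner_colVec_sub_sum_pinv {S : Finset (Fin p)}
    (hS : LinearIndependent ℝ (fun i : S => colVec X i)) (j : Fin p) {i : Fin p} (hi : i ∈ S) :
    inner ℝ (colVec X i) (colVec X j -
      ∑ l : S, ((pinv (subCols X S)).mulVec (X.col j)) l • colVec X l) = 0 := by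
  set A := subCols X S with hA
  have hmul : ∀ c : S → ℝ, WithLp.toLp 2 (A.mulVec c) = ∑ l : S, c l • colVec X l := fun c => by
    ext i
    simp [hA, subCols, colVec, Matrix.mulVec, dotProduct, mul_comm]
  have hunit : IsUnit (A.transpose * A) := by
    rw [← Matrix.mulVec_injective_iff_isUnit]
    intro c d hcd
    have h1 : (A.transpose * A).mulVec (c - d) = 0 := by rw [Matrix.mulVec_sub, hcd, sub_self]
    have h2 : A.mulVec (c - d) = 0 := by
      have : (A.transpose * A).mulVecLin (c - d) = 0 := h1
      have h := (LinearMap.mem_ker).2 this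
      rwa [Matrix.ker_mulVecLin_transpose_mul_self, LinearMap.mem_ker] at h
    have h3 : ∑ l : S, (c - d) l • colVec X l = 0 := by rw [← hmul, h2]; rfl
    ext l
    have := Fintype.linearIndependent_iff.1 hS _ h3 l
    simpa [sub_eq_zero] using this
  have hdet : IsUnit (A.transpose * A).det := (Matrix.isUnit_iff_isUnit_det _).1 hunit
  have hne : A.transpose.mulVec (A.mulVec ((pinv A).mulVec (X.col j))) =
      A.transpose.mulVec (X.col j) := by
    rw [Matrix.mulVec_mulVec, Matrix.mulVec_mulVec, pinv, ← Matrix.mul_assoc,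
      Matrix.mul_nonsing_inv _ hdet, Matrix.one_mul]
  have := congrFun hne ⟨i, hi⟩
  rw [← hmul, inner_sub_right, sub_eq_zero]
  simp only [colVec, EuclideanSpace.inner_toLp_toLp, star_trivial]
  simp only [Matrix.mulVec, Matrix.transpose, hA, subCols, Matrix.submatrix, id] at this
  rw [dotProduct_comm, dotProduct_comm (A.mulVec _)]
  exact this.symm

/-- Modulo the orthogonal complement of the span of `S`, `X_j` is a combination of the columns of
`S` with coefficients of `ℓ¹` norm below `1`, so its correlation with a vector of the span is below
the largest one over `S`. If `X_j` were in the span, it would equal that combination and have norm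
below `1`. -/
lemma dominates_of_exactRecovery {S : Finset (Fin p)} (hX : UnitColumns X)
    (h : ExactRecovery X S) :
    Dominates X S ∧ ∀ j ∉ S, colVec X j ∉ colSpan X S := by
  obtain ⟨hS, hlt⟩ := h
  have horth : ∀ j, ∀ v ∈ colSpan X S, inner ℝ (colVec X j -
      ∑ l : S, ((pinv (subCols X S)).mulVec (X.col j)) l • colVec X l) v = 0 := by
    intro j v hv
    obtain ⟨b, hb, rfl⟩ := exists_apply_eq_of_mem_colSpan hv
    rw [apply_eq_sum_of_supp_subset hb, inner_sum]
    refine Finset.sum_eq_zero fun i hi => ?_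
    rw [inner_smul_right, real_inner_comm, inner_colVec_sub_sum_pinv hS j hi, mul_zero]
  refine ⟨fun x hx hxS j hj => ?_, fun j hj hmem => ?_⟩
  · have hr := apply_mem_colSpan (X := X) hxS
    set r := apply X x
    have hr0 : r ≠ 0 := by
      intro h0
      have h1 : ∑ l : S, x l • colVec X l = 0 := by
        rw [← h0, show r = _ from apply_eq_sum_of_supp_subset hxS]
        exact Finset.sum_coe_sort S fun l => x l • colVec X l
      refine hx ?_
      ext l
      by_cases hl : l ∈ S
      · exact Fintype.linearIndependent_iff.1 hS _ h1 ⟨l, hl⟩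
      · exact apply_eq_zero_of_supp_subset hxS hl
    have hne : S.Nonempty := by
      by_contra hS
      rw [Finset.not_nonempty_iff_eq_empty] at hS
      refine hx ?_
      ext l
      exact apply_eq_zero_of_supp_subset hxS (by simp [hS])
    obtain ⟨i, hi, hmax⟩ := Finset.exists_max_image S (fun l => |inner ℝ (colVec X l) r|) hne
    have hpos : 0 < |inner ℝ (colVec X i) r| := by
      by_contra hle
      refine hr0 (inner_self_eq_zero (𝕜 := ℝ) |>.1 ?_)
      conv_lhs => enter [2]; rw [show r = _ from apply_eq_sum_of_supp_subset hxS]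
      rw [sum_inner]
      refine Finset.sum_eq_zero fun l hl => ?_
      have : inner ℝ (colVec X l) r = 0 := abs_nonpos_iff.1 ((hmax l hl).trans (not_lt.1 hle))
      rw [inner_smul_left, this, mul_zero]
    refine ⟨i, hi, ?_⟩
    have h1 := horth j r hr
    rw [inner_sub_left, sub_eq_zero] at h1
    rw [h1, sum_inner]
    calc |∑ l : S, inner ℝ (((pinv (subCols X S)).mulVec (X.col j)) l • colVec X l) r|
        ≤ ∑ l : S, |((pinv (subCols X S)).mulVec (X.col j)) l| * |inner ℝ (colVec X i) r| := by
          refine (Finset.abs_sum_le_sum_abs _ _).trans (Finset.sum_le_sum fun l _ => ?_)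
          rw [inner_smul_left, abs_mul]
          exact mul_le_mul_of_nonneg_left (hmax l l.2) (abs_nonneg _)
      _ < |inner ℝ (colVec X i) r| := by
          rw [← Finset.sum_mul]
          exact mul_lt_of_lt_one_left hpos (hlt j hj)
  · have hmem' : ∑ l : S, ((pinv (subCols X S)).mulVec (X.col j)) l • colVec X l ∈ colSpan X S :=
      Submodule.sum_mem _ fun l _ => Submodule.smul_mem _ _ (colVec_mem_colSpan l.2)
    have h0 := inner_self_eq_zero.1 (horth j _ (Submodule.sub_mem _ hmem hmem'))
    have h1 : ‖colVec X j‖ < 1 := by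
      rw [sub_eq_zero.1 h0]
      refine ((norm_sum_le _ _).trans_eq ?_).trans_lt (hlt j hj)
      exact Finset.sum_congr rfl fun l _ => by rw [norm_smul, hX, mul_one, Real.norm_eq_abs]
    exact h1.ne (hX j)

/-- The columns indexed by a dominating proper subset span a space of full dimension. -/
lemma finrank_colSpan {S : Finset (Fin p)} (h : Dominates X S) {j : Fin p} (hj : j ∉ S) :
    Module.finrank ℝ (colSpan X S) = S.card := by
  have hind : LinearIndependent ℝ (fun i : S => colVec X i) := by
    rw [Fintype.linearIndependent_iff]
    intro c hc i
    by_contra hi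
    obtain ⟨x, hxS, hxc, hX0⟩ := exists_extension X c
    rw [hc] at hX0
    have hx : x ≠ 0 := fun h0 => hi (by rw [← hxc i, h0]; rfl)
    obtain ⟨l, -, hl⟩ := h x hx hxS j hj
    simp [hX0] at hl
  have := finrank_span_eq_card hind
  rw [Fintype.card_coe] at this
  rw [← this, colSpan, Set.image_eq_range]
  rfl

end LinearAlgebra

end RRT

namespace RRT

/-! ### Orthogonal matching pursuit: recovery, scale invariance, overestimation, measurability -/

section MatchingPursuit

variable {n p : ℕ} {X : Matrix (Fin n) (Fin p) ℝ}
  {pick : Finset (Fin p) → Finset (Fin p) → Fin p}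

lemma residual_add (X : Matrix (Fin n) (Fin p) ℝ) (J : Finset (Fin p))
    (v w : EuclideanSpace ℝ (Fin n)) : residual X J (v + w) = residual X J v + residual X J w := by
  simp only [residual, map_add]
  abel

lemma residual_smul (X : Matrix (Fin n) (Fin p) ℝ) (J : Finset (Fin p)) (c : ℝ)
    (v : EuclideanSpace ℝ (Fin n)) : residual X J (c • v) = c • residual X J v := by
  simp only [residual, map_smul, smul_sub]

lemma residual_eq_zero {J : Finset (Fin p)} {v : EuclideanSpace ℝ (Fin n)}
    (hv : v ∈ colSpan X J) : residual X J v = 0 := by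
  rw [residual, Submodule.starProjection_eq_self_iff.2 hv, sub_self]

lemma residual_apply_add {J : Finset (Fin p)} {β : EuclideanSpace ℝ (Fin p)} (hβ : supp β ⊆ J)
    (w : EuclideanSpace ℝ (Fin n)) : residual X J (apply X β + w) = residual X J w := by
  rw [residual_add, residual_eq_zero (apply_mem_colSpan hβ), zero_add]

lemma residual_mem_orthogonal (X : Matrix (Fin n) (Fin p) ℝ) (J : Finset (Fin p))
    (v : EuclideanSpace ℝ (Fin n)) : residual X J v ∈ (colSpan X J)ᗮ :=
  Submodule.sub_starProjection_mem_orthogonal v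

lemma inner_residual_eq_zero {J : Finset (Fin p)} {u v : EuclideanSpace ℝ (Fin n)}
    (hu : u ∈ colSpan X J) : inner ℝ u (residual X J v) = 0 :=
  residual_mem_orthogonal X J v u hu

lemma inner_residual_left (X : Matrix (Fin n) (Fin p) ℝ) (J : Finset (Fin p))
    (u v : EuclideanSpace ℝ (Fin n)) :
    inner ℝ (residual X J u) (residual X J v) = inner ℝ u (residual X J v) := by
  conv_lhs => enter [2]; rw [residual]
  rw [inner_sub_left, inner_residual_eq_zero (Submodule.starProjection_apply_mem _ _), sub_zero]

lemma continuous_residual (X : Matrix (Fin n) (Fin p) ℝ) (J : Finset (Fin p)) :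
    Continuous (residual X J) :=
  continuous_id.sub (colSpan X J).starProjection.continuous

lemma norm_residual_le {J : Finset (Fin p)} {y v : EuclideanSpace ℝ (Fin n)}
    (hv : v ∈ colSpan X J) : ‖residual X J y‖ ≤ ‖y - v‖ := by
  rw [residual, Submodule.starProjection_minimal]
  exact ciInf_le ⟨0, by rintro _ ⟨x, rfl⟩; exact norm_nonneg _⟩ (⟨v, hv⟩ : colSpan X J)

lemma mem_maximizers {r : EuclideanSpace ℝ (Fin n)} {t : Fin p} :
    t ∈ maximizers X r ↔ ∀ s, |inner ℝ (colVec X s) r| ≤ |inner ℝ (colVec X t) r| := by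
  simp [maximizers]

lemma maximizers_nonempty [Nonempty (Fin p)] (r : EuclideanSpace ℝ (Fin n)) :
    (maximizers X r).Nonempty := by
  obtain ⟨t, ht⟩ := Finite.exists_max fun s => |inner ℝ (colVec X s) r|
  exact ⟨t, mem_maximizers.2 ht⟩

lemma maximizers_smul {c : ℝ} (hc : 0 < c) (r : EuclideanSpace ℝ (Fin n)) :
    maximizers X (c • r) = maximizers X r := by
  ext t
  simp only [mem_maximizers, inner_smul_right, abs_mul, abs_of_pos hc, mul_le_mul_iff_right₀ hc]

lemma ompSupport_mono (y : EuclideanSpace ℝ (Fin n)) : Monotone (ompSupport X pick y) :=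
  monotone_nat_of_le_succ fun _ => Finset.subset_insert _ _

/-! ### Support recovery under small noise -/

/-- Subtracting the projection changes only coefficients in `J`, so those of `β` on `S \ J` survive.
-/
lemma exists_residual_apply_eq {S J : Finset (Fin p)} {β : EuclideanSpace ℝ (Fin p)}
    (hβ : supp β = S) (hJ : J ⊂ S) :
    ∃ x : EuclideanSpace ℝ (Fin p), x ≠ 0 ∧ supp x ⊆ S ∧ residual X J (apply X β) = apply X x := by
  obtain ⟨c, hc, hcp⟩ := exists_apply_eq_of_mem_colSpan
    (Submodule.starProjection_apply_mem (colSpan X J) (apply X β))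
  refine ⟨β - c, fun h0 => ?_, fun l hl => ?_, ?_⟩
  · obtain ⟨j, hj, hjJ⟩ := Finset.exists_of_ssubset hJ
    rw [← hβ, mem_supp] at hj
    have := congrArg (fun v : EuclideanSpace ℝ (Fin p) => v j) h0
    simp [apply_eq_zero_of_supp_subset hc hjJ, hj] at this
  · by_contra h
    refine mem_supp.1 hl ?_
    simp [apply_eq_zero_of_supp_subset (hc.trans hJ.1) h, apply_eq_zero_of_supp_subset hβ.le h]
  · rw [apply_sub, hcp, residual]

/-- The strict inequalities hold without noise, are open conditions on `w`, and are finite in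
number. -/
lemma eventually_maximizers_subset {S : Finset (Fin p)} {β : EuclideanSpace ℝ (Fin p)}
    (hβ : supp β = S) (hX : Dominates X S) {j : Fin p} (hj : j ∉ S) :
    ∀ᶠ w in 𝓝 0, ∀ J, J ⊂ S → maximizers X (residual X J (apply X β + w)) ⊆ S \ J := by
  rw [eventually_all]
  intro J
  rw [eventually_imp_distrib_left]
  intro hJ
  obtain ⟨x, hx, hxS, hr⟩ := exists_residual_apply_eq (X := X) hβ hJ
  have key : ∀ t, ∃ i, t ∉ S \ J → ∀ᶠ w in 𝓝 0,
      |inner ℝ (colVec X t) (residual X J (apply X β + w))| <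
        |inner ℝ (colVec X i) (residual X J (apply X β + w))| := by
    intro t
    have hcont : ∀ i, Tendsto (fun w => |inner ℝ (colVec X i) (residual X J (apply X β + w))|)
        (𝓝 0) (𝓝 |inner ℝ (colVec X i) (apply X x)|) := fun i => by
      have : Continuous fun w => |inner ℝ (colVec X i) (residual X J (apply X β + w))| := by
        have := continuous_residual X J
        fun_prop
      simpa [hr] using this.tendsto 0
    by_cases htS : t ∈ S
    -- An index of `J` has zero correlation for every `w`; the outside column `j` serves only to
    -- produce some `i` with positive correlation.
    · obtain ⟨i, -, hi⟩ := hX x hx hxS j hj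
      refine ⟨i, fun ht => ?_⟩
      have htJ : t ∈ J := by
        by_contra h
        exact ht (Finset.mem_sdiff.2 ⟨htS, h⟩)
      have hi0 := (abs_nonneg _).trans_lt hi
      filter_upwards [(hcont i).eventually (eventually_gt_nhds hi0)] with w hw
      rwa [inner_residual_eq_zero (colVec_mem_colSpan htJ), abs_zero]
    · obtain ⟨i, -, hi⟩ := hX x hx hxS t htS
      exact ⟨i, fun _ => (hcont t).eventually_lt (hcont i) hi⟩
  choose i hi using key
  have : ∀ᶠ w in 𝓝 0, ∀ t, t ∉ S \ J →
      |inner ℝ (colVec X t) (residual X J (apply X β + w))| <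
        |inner ℝ (colVec X (i t)) (residual X J (apply X β + w))| := by
    rw [eventually_all]
    intro t
    rw [eventually_imp_distrib_left]
    exact hi t
  filter_upwards [this] with w hw t ht
  by_contra h
  exact absurd (mem_maximizers.1 ht (i t)) (not_le.2 (hw t h))

lemma ompSupport_card_eq [Nonempty (Fin p)]
    (hpick : ∀ J A : Finset (Fin p), A.Nonempty → pick J A ∈ A) {S : Finset (Fin p)}
    {y : EuclideanSpace ℝ (Fin n)} (h : ∀ J, J ⊂ S → maximizers X (residual X J y) ⊆ S \ J) :
    ompSupport X pick y S.card = S := by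
  have : ∀ k ≤ S.card, ompSupport X pick y k ⊆ S ∧ (ompSupport X pick y k).card = k := by
    intro k
    induction k with
    | zero => simp [ompSupport]
    | succ k ih =>
      intro hk
      obtain ⟨h1, h2⟩ := ih (by omega)
      have hss : ompSupport X pick y k ⊂ S := by
        refine h1.ssubset_of_ne fun h => ?_
        rw [h] at h2
        omega
      have ht := Finset.mem_sdiff.1 (h _ hss (hpick (ompSupport X pick y k) _
        (maximizers_nonempty (residual X (ompSupport X pick y k) y))))
      exact ⟨Finset.insert_subset ht.1 h1, by
        rw [ompSupport, Finset.card_insert_of_notMem ht.2, h2]⟩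
  obtain ⟨h1, h2⟩ := this _ le_rfl
  exact Finset.eq_of_subset_of_card_le h1 h2.ge

/-! ### Dependence of the estimate on the observation -/

/-- Positive scaling preserves the maximizers, and the tie rule sees only the support and the
maximizers. -/
lemma ompSupport_eq_of_residual_eq_smul {S : Finset (Fin p)} {k₀ : ℕ}
    {y y' : EuclideanSpace ℝ (Fin n)} (hy : ompSupport X pick y k₀ = S)
    (hy' : ompSupport X pick y' k₀ = S) {c : ℝ} (hc : 0 < c)
    (hres : ∀ J, S ⊆ J → residual X J y' = c • residual X J y) {k : ℕ} (hk : k₀ ≤ k) :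
    ompSupport X pick y' k = ompSupport X pick y k := by
  induction k, hk using Nat.le_induction with
  | base => rw [hy, hy']
  | succ k hk ih =>
    have hS : S ⊆ ompSupport X pick y k := hy ▸ ompSupport_mono y hk
    rw [ompSupport, ompSupport, ih, hres _ hS, maximizers_smul hc]

lemma residualRatio_eq_of_residual_eq_smul {S : Finset (Fin p)} {k₀ : ℕ}
    {y y' : EuclideanSpace ℝ (Fin n)} (hy : ompSupport X pick y k₀ = S)
    (hy' : ompSupport X pick y' k₀ = S) {c : ℝ} (hc : 0 < c)
    (hres : ∀ J, S ⊆ J → residual X J y' = c • residual X J y) {k : ℕ} (hk : k₀ < k) :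
    residualRatio X pick y' k = residualRatio X pick y k := by
  have hS : ∀ l, k₀ ≤ l → S ⊆ ompSupport X pick y l := fun l hl => hy ▸ ompSupport_mono y hl
  have hk' : k₀ ≤ k - 1 := by omega
  rw [residualRatio, residualRatio, ompSupport_eq_of_residual_eq_smul hy hy' hc hres hk.le,
    ompSupport_eq_of_residual_eq_smul hy hy' hc hres hk', hres _ (hS _ hk.le), hres _ (hS _ hk'),
    norm_smul, norm_smul, mul_div_mul_left _ _ (norm_ne_zero_iff.2 hc.ne')]

lemma le_rrtIndex {kmax k : ℕ} {α : ℝ} {y : EuclideanSpace ℝ (Fin n)} (hk : k ∈ Finset.Icc 1 kmax)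
    (h : residualRatio X pick y k < rrtThreshold n p kmax α k) :
    k ≤ rrtIndex X pick kmax α y := by
  classical
  exact Finset.le_sup (f := id) (Finset.mem_filter.2 ⟨hk, h⟩)

lemma rrtIndex_spec {kmax : ℕ} {α : ℝ} {y : EuclideanSpace ℝ (Fin n)}
    (h : rrtIndex X pick kmax α y ≠ 0) :
    rrtIndex X pick kmax α y ∈ Finset.Icc 1 kmax ∧
      residualRatio X pick y (rrtIndex X pick kmax α y) <
        rrtThreshold n p kmax α (rrtIndex X pick kmax α y) := by
  classical
  have hne : ((Finset.Icc 1 kmax).filter fun k =>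
      residualRatio X pick y k < rrtThreshold n p kmax α k).Nonempty := by
    by_contra hemp
    rw [Finset.not_nonempty_iff_eq_empty] at hemp
    refine h ?_
    rw [rrtIndex]
    convert! Finset.sup_empty
  obtain ⟨k, hk, hk'⟩ := Finset.exists_mem_eq_sup _ hne id
  have hk' : rrtIndex X pick kmax α y = k := by
    rw [rrtIndex]
    convert! hk'
  rw [hk']
  exact Finset.mem_filter.1 hk

/-- Ratios up to step `k₀` may differ between `y` and `y'`, but a last crossing beyond `k₀` depends
only on later ratios, which agree. -/
lemma ssubset_rrtSupport_of_residual_eq_smul {S : Finset (Fin p)} {k₀ kmax : ℕ} {α : ℝ}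
    {y y' : EuclideanSpace ℝ (Fin n)} (hy : ompSupport X pick y k₀ = S)
    (hy' : ompSupport X pick y' k₀ = S) {c : ℝ} (hc : 0 < c)
    (hres : ∀ J, S ⊆ J → residual X J y' = c • residual X J y)
    (h : S ⊂ rrtSupport X pick kmax α y) : S ⊂ rrtSupport X pick kmax α y' := by
  have hlt : k₀ < rrtIndex X pick kmax α y := by
    by_contra hle
    exact h.2 (hy ▸ ompSupport_mono y (not_lt.1 hle))
  have hs := rrtIndex_spec (ne_zero_of_lt hlt)
  have h1 : rrtIndex X pick kmax α y ≤ rrtIndex X pick kmax α y' := by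
    refine le_rrtIndex hs.1 ?_
    rw [residualRatio_eq_of_residual_eq_smul hy hy' hc hres hlt]
    exact hs.2
  have hlt' := hlt.trans_le h1
  have hs' := rrtIndex_spec (ne_zero_of_lt hlt')
  rw [residualRatio_eq_of_residual_eq_smul hy hy' hc hres hlt'] at hs'
  have h2 := le_rrtIndex hs'.1 hs'.2
  rw [rrtSupport, ← h1.antisymm h2, ompSupport_eq_of_residual_eq_smul hy hy' hc hres hlt.le]
  exact h

lemma ssubset_rrtSupport_iff_of_residual_eq_smul {S : Finset (Fin p)} {k₀ kmax : ℕ} {α : ℝ}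
    {y y' : EuclideanSpace ℝ (Fin n)} (hy : ompSupport X pick y k₀ = S)
    (hy' : ompSupport X pick y' k₀ = S) {c : ℝ} (hc : 0 < c)
    (hres : ∀ J, S ⊆ J → residual X J y' = c • residual X J y) :
    S ⊂ rrtSupport X pick kmax α y ↔ S ⊂ rrtSupport X pick kmax α y' :=
  ⟨ssubset_rrtSupport_of_residual_eq_smul hy hy' hc hres,
    ssubset_rrtSupport_of_residual_eq_smul hy' hy (inv_pos.2 hc) fun J hJ => by
      rw [hres J hJ, inv_smul_smul₀ hc.ne']⟩

/-! ### Overestimation of the support -/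

/-- The projection onto the larger span is at least as close to `y` as the competitor obtained by
adding the component along the new residual direction. -/
lemma norm_residual_insert_sq_le {S : Finset (Fin p)} (y : EuclideanSpace ℝ (Fin n)) {t : Fin p}
    (ht : residual X S (colVec X t) ≠ 0) :
    ‖residual X (insert t S) y‖ ^ 2 ≤ ‖residual X S y‖ ^ 2 -
      inner ℝ (colVec X t) (residual X S y) ^ 2 / ‖residual X S (colVec X t)‖ ^ 2 := by
  set h := residual X S (colVec X t) with hh
  set r := residual X S y with hr
  set a := inner ℝ (colVec X t) r with ha
  have hinner : inner ℝ r h = a := by rw [real_inner_comm, hh, hr, inner_residual_left]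
  have hmem : (colSpan X S).starProjection y + (a / ‖h‖ ^ 2) • h ∈ colSpan X (insert t S) := by
    have hle := colSpan_mono (X := X) (Finset.subset_insert t S)
    refine Submodule.add_mem _ (hle (Submodule.starProjection_apply_mem _ _))
      (Submodule.smul_mem _ _ (Submodule.sub_mem _ (colVec_mem_colSpan (Finset.mem_insert_self t S))
        (hle (Submodule.starProjection_apply_mem _ _))))
  refine (pow_le_pow_left₀ (norm_nonneg _) (norm_residual_le hmem) 2).trans_eq ?_
  rw [← sub_sub, show y - (colSpan X S).starProjection y = r from rfl, norm_sub_sq_real,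
    inner_smul_right, hinner, norm_smul, mul_pow, Real.norm_eq_abs, sq_abs]
  have : ‖h‖ ^ 2 ≠ 0 := pow_ne_zero 2 (norm_ne_zero_iff.2 ht)
  field_simp
  ring

/-- If one more fixed direction reduces the residual by a ratio below the threshold, then the
support is overestimated, provided that the direction is that of the column with the largest
residual norm. -/
lemma ssubset_rrtSupport_of_ratio_lt (hpick : ∀ J A : Finset (Fin p), A.Nonempty → pick J A ∈ A)
    {S : Finset (Fin p)} {kmax : ℕ} {α : ℝ} {y : EuclideanSpace ℝ (Fin n)}
    (hy : ompSupport X pick y S.card = S) (hkmax : S.card < kmax) {j : Fin p}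
    (hmax : ∀ t, ‖residual X S (colVec X t)‖ ≤ ‖residual X S (colVec X j)‖)
    (hne : inner ℝ (colVec X j) (residual X S y) ≠ 0)
    (hlt : √((‖residual X S y‖ ^ 2 - inner ℝ (colVec X j) (residual X S y) ^ 2 /
      ‖residual X S (colVec X j)‖ ^ 2) / ‖residual X S y‖ ^ 2) <
        rrtThreshold n p kmax α (S.card + 1)) :
    S ⊂ rrtSupport X pick kmax α y := by
  have : Nonempty (Fin p) := ⟨j⟩
  set r := residual X S y with hr
  set t := pick S (maximizers X r)
  have ht : ∀ s, |inner ℝ (colVec X s) r| ≤ |inner ℝ (colVec X t) r| :=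
    mem_maximizers.1 (hpick S _ (maximizers_nonempty r))
  have htne : inner ℝ (colVec X t) r ≠ 0 := abs_pos.1 ((abs_pos.2 hne).trans_le (ht j))
  have htS : t ∉ S := fun h => htne (inner_residual_eq_zero (colVec_mem_colSpan h))
  have hht : residual X S (colVec X t) ≠ 0 := fun h => htne (by
    rw [hr, ← inner_residual_left, h, inner_zero_left])
  have hsucc : ompSupport X pick y (S.card + 1) = insert t S := by
    rw [ompSupport, hy]
  have hRR : residualRatio X pick y (S.card + 1) < rrtThreshold n p kmax α (S.card + 1) := by
    refine lt_of_le_of_lt ?_ hlt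
    rw [residualRatio, hsucc, Nat.add_sub_cancel, hy]
    refine Real.le_sqrt_of_sq_le ?_
    rw [div_pow]
    refine div_le_div_of_nonneg_right ?_ (sq_nonneg _)
    refine (norm_residual_insert_sq_le y hht).trans (sub_le_sub_left ?_ _)
    -- The greedy choice enlarges the numerator, and maximality of `j` bounds the denominator.
    refine div_le_div₀ (sq_nonneg _) (sq_le_sq.2 (ht j)) ?_
      (pow_le_pow_left₀ (norm_nonneg _) (hmax t) 2)
    have := norm_pos_iff.2 hht
    positivity
  have hidx := le_rrtIndex (Finset.mem_Icc.2 ⟨by omega, hkmax⟩) hRR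
  refine (Finset.ssubset_insert htS).trans_subset ?_
  rw [← hsucc]
  exact ompSupport_mono y hidx

/-! ### Measurability -/

/-- Splitting over the values of a discrete statistic reduces data-dependent supports to fixed ones.
-/
lemma measurableSet_comp_countable {Ω A : Type*} [MeasurableSpace Ω] [Countable A] {f : Ω → A}
    (hf : ∀ a, MeasurableSet {ω | f ω = a}) {R : A → Ω → Prop}
    (hR : ∀ a, MeasurableSet {ω | R a ω}) : MeasurableSet {ω | R (f ω) ω} := by
  have : {ω | R (f ω) ω} = ⋃ a, {ω | f ω = a} ∩ {ω | R a ω} := by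
    ext ω
    simp
  rw [this]
  exact MeasurableSet.iUnion fun a => (hf a).inter (hR a)

lemma measurableSet_finset_eq {Ω ι : Type*} [MeasurableSpace Ω] [Countable ι] {f : Ω → Finset ι}
    (hf : ∀ i, MeasurableSet {ω | i ∈ f ω}) (B : Finset ι) : MeasurableSet {ω | f ω = B} := by
  have : {ω | f ω = B} = ⋂ i, {ω | i ∈ f ω ↔ i ∈ B} := by
    ext ω
    simp [Finset.ext_iff]
  rw [this]
  refine MeasurableSet.iInter fun i => ?_
  by_cases hi : i ∈ B
  · simpa [hi] using hf i
  · convert! (hf i).compl using 1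
    ext ω
    simp [hi]

lemma measurableSet_maximizers_eq (J A : Finset (Fin p)) :
    MeasurableSet {y | maximizers X (residual X J y) = A} := by
  refine measurableSet_finset_eq (fun t => ?_) A
  simp only [mem_maximizers, Set.ofPred_forall]
  have := continuous_residual X J
  exact MeasurableSet.iInter fun s => measurableSet_le (by fun_prop) (by fun_prop)

lemma measurableSet_ompSupport_eq (k : ℕ) (J : Finset (Fin p)) :
    MeasurableSet {y | ompSupport X pick y k = J} := by
  induction k generalizing J with
  | zero => simp [ompSupport]
  | succ k ih =>
    exact measurableSet_comp_countable (f := fun y => ompSupport X pick y k) ih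
      (R := fun I y => insert (pick I (maximizers X (residual X I y))) I = J) fun I =>
        measurableSet_comp_countable (f := fun y => maximizers X (residual X I y))
          (measurableSet_maximizers_eq I) (R := fun B _ => insert (pick I B) I = J) fun B => by simp

lemma measurableSet_residualRatio_lt (k : ℕ) (c : ℝ) :
    MeasurableSet {y | residualRatio X pick y k < c} := by
  refine measurableSet_comp_countable (f := fun y => ompSupport X pick y k)
    (measurableSet_ompSupport_eq k)
    (R := fun I y => ‖residual X I y‖ / ‖residual X (ompSupport X pick y (k - 1)) y‖ < c)
    fun I => ?_
  refine measurableSet_comp_countable (f := fun y => ompSupport X pick y (k - 1))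
    (measurableSet_ompSupport_eq (k - 1))
    (R := fun I' y => ‖residual X I y‖ / ‖residual X I' y‖ < c) fun I' => ?_
  have h1 := (continuous_residual X I).measurable
  have h2 := (continuous_residual X I').measurable
  exact measurableSet_lt (by fun_prop) measurable_const

lemma measurableSet_ssubset_rrtSupport (S : Finset (Fin p)) (kmax : ℕ) (α : ℝ) :
    MeasurableSet {y | S ⊂ rrtSupport X pick kmax α y} := by
  classical
  have hF : ∀ B, MeasurableSet {y | ((Finset.Icc 1 kmax).filter fun k =>
      residualRatio X pick y k < rrtThreshold n p kmax α k) = B} := by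
    refine measurableSet_finset_eq fun k => ?_
    simp only [Finset.mem_filter, Set.ofPred_and]
    exact (MeasurableSet.const _).inter (measurableSet_residualRatio_lt _ _)
  have := measurableSet_comp_countable hF (R := fun B y => S ⊂ ompSupport X pick y (B.sup id))
    fun B => measurableSet_comp_countable (measurableSet_ompSupport_eq (B.sup id))
      (R := fun J _ => S ⊂ J) fun J => MeasurableSet.const _
  convert! this

end MatchingPursuit

end RRT

namespace RRT

/-! ### Gamma and beta laws, and Gaussian residual ratios -/

section Distributions

open scoped ENNReal

lemma lintegral_eq_ofReal_mul_lintegral_comp_mul_left {f : ℝ → ℝ≥0∞} (hf : Measurable f) {a : ℝ}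
    (ha : 0 < a) : ∫⁻ x, f x = ENNReal.ofReal a * ∫⁻ x, f (a * x) := by
  rw [← lintegral_map hf (measurable_const_mul a), Real.map_volume_mul_left ha.ne',
    lintegral_smul_measure, smul_eq_mul, ← mul_assoc, ← ENNReal.ofReal_mul ha.le,
    abs_of_pos (inv_pos.2 ha), mul_inv_cancel₀ ha.ne', ENNReal.ofReal_one, one_mul]

lemma measurable_gammaPDF (a r : ℝ) : Measurable (gammaPDF a r) :=
  (measurable_gammaPDFReal a r).ennreal_ofReal

lemma measurable_betaPDF (a b : ℝ) : Measurable (betaPDF a b) :=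
  (measurable_betaPDFReal a b).ennreal_ofReal

/-- The factor `s` is the Jacobian of `x = s u`, `y = s (1 - u)`. The endpoints `u = 0, 1` are
excluded because the density conventions there need not match. -/
lemma gammaPDF_mul_gammaPDF_eq {a b r s u : ℝ} (ha : 0 < a) (hb : 0 < b) (hr : 0 < r) (hs : 0 < s)
    (hu₀ : u ≠ 0) (hu₁ : u ≠ 1) :
    ENNReal.ofReal s * (gammaPDF a r (s * u) * gammaPDF b r (s - s * u)) =
      gammaPDF (a + b) r s * betaPDF a b u := by
  rcases lt_or_gt_of_ne hu₀ with hu | hu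
  · rw [gammaPDF_of_neg (mul_neg_of_pos_of_neg hs hu), betaPDF_eq_zero_of_nonpos hu.le]; simp
  rcases lt_or_gt_of_ne hu₁ with hu' | hu'
  swap
  · rw [gammaPDF_of_neg (x := s - s * u) (by nlinarith), betaPDF_eq_zero_of_one_le hu'.le]; simp
  have h1 : 0 < 1 - u := by linarith
  have e : s - s * u = s * (1 - u) := by ring
  rw [e, gammaPDF_of_nonneg (by positivity), gammaPDF_of_nonneg (by positivity),
    gammaPDF_of_nonneg hs.le, betaPDF_of_pos_lt_one hu hu',
    ← ENNReal.ofReal_mul (by positivity), ← ENNReal.ofReal_mul hs.le,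
    ← ENNReal.ofReal_mul (by positivity)]
  congr 1
  have hexp : Real.exp (-(r * s)) =
      Real.exp (-(r * (s * u))) * Real.exp (-(r * (s * (1 - u)))) := by
    rw [← Real.exp_add]; congr 1; ring
  have hs' : s ^ (a + b - 1) = s * s ^ (a - 1) * s ^ (b - 1) := by
    rw [show a + b - 1 = 1 + (a - 1) + (b - 1) by ring, Real.rpow_add hs, Real.rpow_add hs,
      Real.rpow_one]
  have hab := (Real.Gamma_pos_of_pos (add_pos ha hb)).ne'
  have ha' := (Real.Gamma_pos_of_pos ha).ne'
  have hb' := (Real.Gamma_pos_of_pos hb).ne'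
  rw [hexp, hs', Real.mul_rpow hs.le hu.le, Real.mul_rpow hs.le h1.le, Real.rpow_add hr,
    ProbabilityTheory.beta]
  field_simp

/-- The planar change of variables is done one coordinate at a time: shift to `s = x + y`, swap the
integrals, then rescale `x = s u`. -/
lemma lintegral_gammaPDF_mul_gammaPDF {a b r : ℝ} (ha : 0 < a) (hb : 0 < b) (hr : 0 < r)
    {φ : ℝ × ℝ → ℝ≥0∞} (hφ : Measurable φ) :
    ∫⁻ x, ∫⁻ y, gammaPDF a r x * gammaPDF b r y * φ (x + y, x / (x + y)) =
      ∫⁻ s, ∫⁻ u, gammaPDF (a + b) r s * betaPDF a b u * φ (s, u) := by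
  have mg := measurable_gammaPDF
  have mb := measurable_betaPDF
  calc ∫⁻ x, ∫⁻ y, gammaPDF a r x * gammaPDF b r y * φ (x + y, x / (x + y))
      = ∫⁻ x, ∫⁻ s, gammaPDF a r x * gammaPDF b r (s - x) * φ (s, x / s) := by
        refine lintegral_congr fun x => ?_
        rw [← lintegral_sub_right_eq_self
          (fun y => gammaPDF a r x * gammaPDF b r y * φ (x + y, x / (x + y))) x]
        simp
    _ = ∫⁻ s, ∫⁻ x, gammaPDF a r x * gammaPDF b r (s - x) * φ (s, x / s) := by
        refine lintegral_lintegral_swap (Measurable.aemeasurable ?_)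
        have := mg a r
        have := mg b r
        unfold Function.uncurry
        fun_prop
    _ = _ := by
        refine lintegral_congr_ae ?_
        filter_upwards [Measure.ae_ne volume (0 : ℝ)] with s hs
        rcases lt_or_gt_of_ne hs with hs | hs
        · simp only [gammaPDF_of_neg hs, zero_mul, lintegral_zero]
          rw [lintegral_eq_zero_iff (by have := mg a r; have := mg b r; fun_prop)]
          refine ae_of_all _ fun x => ?_
          rcases lt_or_ge x 0 with hx | hx
          · simp [gammaPDF_of_neg hx]
          · simp [gammaPDF_of_neg (x := s - x) (by linarith)]
        · rw [lintegral_eq_ofReal_mul_lintegral_comp_mul_left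
            (by have := mg a r; have := mg b r; fun_prop) hs, ← lintegral_const_mul]
          swap
          · have := mg a r
            have := mg b r
            fun_prop
          refine lintegral_congr_ae ?_
          filter_upwards [Measure.ae_ne volume (0 : ℝ), Measure.ae_ne volume (1 : ℝ)] with u h0 h1
          rw [← mul_assoc, gammaPDF_mul_gammaPDF_eq ha hb hr hs h0 h1,
            mul_div_cancel_left₀ _ hs.ne']

/-- For independent gamma variables `x`, `y` with a common rate, `x + y` and `x / (x + y)` are
independent with a gamma and a beta distribution. -/
theorem map_prod_gammaMeasure {a b r : ℝ} (ha : 0 < a) (hb : 0 < b) (hr : 0 < r) :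
    ((gammaMeasure a r).prod (gammaMeasure b r)).map (fun z => (z.1 + z.2, z.1 / (z.1 + z.2))) =
      (gammaMeasure (a + b) r).prod (betaMeasure a b) := by
  have mg := measurable_gammaPDF
  have mb := measurable_betaPDF
  refine Measure.ext_of_lintegral _ fun φ hφ => ?_
  have m1 := mg a r
  have m2 := mg b r
  have m3 := mg (a + b) r
  have m4 := mb a b
  rw [lintegral_map hφ (by fun_prop)]
  unfold gammaMeasure betaMeasure
  rw [prod_withDensity m1 m2, prod_withDensity m3 m4,
    lintegral_withDensity_eq_lintegral_mul _ (by fun_prop) (by fun_prop),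
    lintegral_withDensity_eq_lintegral_mul _ (by fun_prop) hφ,
    lintegral_prod _ (by fun_prop), lintegral_prod _ (by fun_prop)]
  exact lintegral_gammaPDF_mul_gammaPDF ha hb hr hφ

theorem map_add_prod_gammaMeasure {a b r : ℝ} (ha : 0 < a) (hb : 0 < b) (hr : 0 < r) :
    ((gammaMeasure a r).prod (gammaMeasure b r)).map (fun z => z.1 + z.2) =
      gammaMeasure (a + b) r := by
  have := isProbabilityMeasureBeta ha hb
  have := isProbabilityMeasure_gammaMeasure (add_pos ha hb) hr
  have h := congrArg (Measure.map Prod.fst) (map_prod_gammaMeasure ha hb hr)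
  rwa [Measure.map_map measurable_fst (by fun_prop), Measure.map_fst_prod, measure_univ,
    one_smul] at h

theorem map_div_prod_gammaMeasure {a b r : ℝ} (ha : 0 < a) (hb : 0 < b) (hr : 0 < r) :
    ((gammaMeasure a r).prod (gammaMeasure b r)).map (fun z => z.1 / (z.1 + z.2)) =
      betaMeasure a b := by
  have := isProbabilityMeasureBeta ha hb
  have := isProbabilityMeasure_gammaMeasure (add_pos ha hb) hr
  have h := congrArg (Measure.map Prod.snd) (map_prod_gammaMeasure ha hb hr)
  rwa [Measure.map_map measurable_snd (by fun_prop), Measure.map_snd_prod, measure_univ,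
    one_smul] at h

/-- The square of a standard Gaussian variable is chi-squared distributed. -/
theorem map_sq_gaussianReal :
    (gaussianReal 0 1).map (fun x => x ^ 2) = gammaMeasure (1 / 2) (1 / 2) := by
  refine Measure.ext_of_lintegral _ fun φ hφ => ?_
  rw [lintegral_map hφ (by fun_prop), gaussianReal_of_var_ne_zero _ one_ne_zero,
    lintegral_withDensity_eq_lintegral_mul _ (measurable_gaussianPDF 0 1) (by fun_prop),
    gammaMeasure, lintegral_withDensity_eq_lintegral_mul _ (measurable_gammaPDF _ _) hφ]
  simp only [Pi.mul_apply]
  set F : ℝ → ℝ≥0∞ := fun x => gaussianPDF 0 1 x * φ (x ^ 2) with hF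
  have mF : Measurable F := by
    have := measurable_gaussianPDF 0 1
    fun_prop
  have heven : ∀ x, F (-x) = F x := fun x => by simp [hF, gaussianPDF, gaussianPDFReal]
  have hneg : ∫⁻ x in Set.Iio 0, F x = ∫⁻ x in Set.Ioi 0, F x := by
    rw [← lintegral_indicator measurableSet_Iio, ← lintegral_indicator measurableSet_Ioi,
      ← lintegral_neg_eq_self]
    refine lintegral_congr fun x => ?_
    simp [Set.indicator, heven]
  have hsplit : ∫⁻ x, F x = 2 * ∫⁻ x in Set.Ioi 0, F x := by
    rw [← lintegral_add_compl _ (measurableSet_Iio (a := (0 : ℝ))), Set.compl_Iio,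
      setLIntegral_congr Ioi_ae_eq_Ici.symm, hneg, two_mul]
  have himg : (fun x : ℝ => x ^ 2) '' Set.Ioi 0 = Set.Ioi 0 := by
    ext t
    constructor
    · rintro ⟨x, hx, rfl⟩
      exact pow_pos (Set.mem_Ioi.1 hx) 2
    · intro ht
      exact ⟨√t, Real.sqrt_pos.2 ht, Real.sq_sqrt (le_of_lt ht)⟩
  have hinj : Set.InjOn (fun x : ℝ => x ^ 2) (Set.Ioi 0) := fun x hx y hy h =>
    (pow_left_inj₀ (le_of_lt hx) (le_of_lt hy) two_ne_zero).1 h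
  have hcv := lintegral_image_eq_lintegral_abs_deriv_mul (f := fun x : ℝ => x ^ 2)
    (f' := fun x => 2 * x) measurableSet_Ioi
    (fun x _ => by simpa using (hasDerivAt_pow 2 x).hasDerivWithinAt) hinj
    (fun t => gammaPDF (1 / 2) (1 / 2) t * φ t)
  rw [himg] at hcv
  have hR : ∫⁻ t, gammaPDF (1 / 2) (1 / 2) t * φ t =
      ∫⁻ t in Set.Ioi 0, gammaPDF (1 / 2) (1 / 2) t * φ t := by
    rw [← lintegral_add_compl _ (measurableSet_Iio (a := (0 : ℝ))), Set.compl_Iio,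
      setLIntegral_congr Ioi_ae_eq_Ici.symm, setLIntegral_congr_fun (g := fun _ => 0)
        measurableSet_Iio fun x hx => by simp [gammaPDF_of_neg (Set.mem_Iio.1 hx)]]
    simp
  rw [hsplit, hR, hcv, ← lintegral_const_mul _ mF]
  refine setLIntegral_congr_fun measurableSet_Ioi fun x hx => ?_
  have hx : 0 < x := hx
  simp only [hF]
  rw [← mul_assoc, ← mul_assoc]
  congr 1
  rw [gammaPDF_of_nonneg (by positivity), gaussianPDF, gaussianPDFReal,
    ← ENNReal.ofReal_mul (by positivity), show (2 : ℝ≥0∞) = ENNReal.ofReal 2 by simp,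
    ← ENNReal.ofReal_mul (by positivity), abs_of_pos (by positivity), Real.Gamma_one_half_eq]
  congr 1
  have e : (x ^ 2) ^ ((1 : ℝ) / 2 - 1) = x⁻¹ := by
    rw [← Real.rpow_natCast, ← Real.rpow_mul hx.le, ← Real.rpow_neg_one]
    norm_num
  have e2 : ((1 : ℝ) / 2) ^ ((1 : ℝ) / 2) = (√2)⁻¹ := by
    rw [← Real.sqrt_eq_rpow, ← Real.sqrt_inv]
    norm_num
  rw [e, e2]
  simp only [NNReal.coe_one, mul_one, sub_zero]
  rw [Real.sqrt_mul (by norm_num)]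
  have : -x ^ 2 / 2 = -(1 / 2 * x ^ 2) := by ring
  rw [this]
  field_simp

lemma map_sum_sq_eq_gammaMeasure {ι Ω : Type*} [MeasurableSpace Ω] {P : Measure Ω}
    [IsProbabilityMeasure P] {Y : ι → Ω → ℝ} (hY : ∀ i, Measurable (Y i)) (hind : iIndepFun Y P)
    (hlaw : ∀ i, P.map (Y i) = gammaMeasure (1 / 2) (1 / 2)) {s : Finset ι} (hs : s.Nonempty) :
    P.map (∑ i ∈ s, Y i) = gammaMeasure (s.card / 2) (1 / 2) := by
  induction hs using Finset.Nonempty.cons_induction with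
  | singleton i => simpa using hlaw i
  | cons i s hi hs ih =>
    have hi' := hind.indepFun_finsetSum_of_notMem hY hi
    have hms : Measurable (∑ j ∈ s, Y j) := by
      simpa only [Finset.sum_fn] using Finset.measurable_sum s fun j _ => hY j
    have hm := (indepFun_iff_map_prod_eq_prod_map_map hms.aemeasurable (hY i).aemeasurable).1 hi'
    have hpos : (0 : ℝ) < s.card / 2 := by
      have := hs.card_pos
      positivity
    have h := map_add_prod_gammaMeasure hpos (one_half_pos (α := ℝ)) (one_half_pos (α := ℝ))
    rw [← ih, ← hlaw i, ← hm, Measure.map_map (by fun_prop) (by fun_prop)] at h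
    have e : ((Finset.cons i s hi).card : ℝ) / 2 = s.card / 2 + 1 / 2 := by
      rw [Finset.card_cons]; push_cast; ring
    rw [e, ← h]
    congr 1
    ext ω
    simp [add_comm]

lemma map_sum_sq_div_eq_betaMeasure {ι Ω : Type*} [MeasurableSpace Ω] {P : Measure Ω}
    [IsProbabilityMeasure P] {Y : ι → Ω → ℝ} (hY : ∀ i, Measurable (Y i)) (hind : iIndepFun Y P)
    (hlaw : ∀ i, P.map (Y i) = gammaMeasure (1 / 2) (1 / 2)) {s : Finset ι} (hs : s.Nonempty)
    {i : ι} (hi : i ∉ s) :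
    P.map (fun ω => (∑ j ∈ s, Y j ω) / (∑ j ∈ s, Y j ω + Y i ω)) =
      betaMeasure (s.card / 2) (1 / 2) := by
  have hms : Measurable (∑ j ∈ s, Y j) := by
    simpa only [Finset.sum_fn] using Finset.measurable_sum s fun j _ => hY j
  have hm := (indepFun_iff_map_prod_eq_prod_map_map hms.aemeasurable (hY i).aemeasurable).1
    (hind.indepFun_finsetSum_of_notMem hY hi)
  have hpos : (0 : ℝ) < s.card / 2 := by
    have := hs.card_pos
    positivity
  rw [← map_div_prod_gammaMeasure hpos (one_half_pos (α := ℝ)) (one_half_pos (α := ℝ)), ← hlaw i,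
    ← map_sum_sq_eq_gammaMeasure hY hind hlaw hs, ← hm,
    Measure.map_map (by fun_prop) (by fun_prop)]
  congr 1
  ext ω
  simp

variable {E : Type*} [NormedAddCommGroup E] [InnerProductSpace ℝ E] [FiniteDimensional ℝ E]

/-- A unit vector orthogonal to a subspace `V` is the first vector of an orthonormal basis whose
first part spans the orthogonal complement of `V`. -/
lemma exists_orthonormalBasis_orthogonal {V : Submodule ℝ E} {m : ℕ}
    (hV : Module.finrank ℝ Vᗮ = m + 1) {u : E} (hu : u ∈ Vᗮ) (hu₁ : ‖u‖ = 1) :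
    ∃ b : OrthonormalBasis (Fin (m + 1) ⊕ Fin (Module.finrank ℝ V)) ℝ E, b (Sum.inl 0) = u ∧
      ∀ z : E, ‖z - V.starProjection z‖ ^ 2 = ∑ i, inner ℝ (b (Sum.inl i)) z ^ 2 := by
  obtain ⟨c, hc⟩ := Orthonormal.exists_orthonormalBasis_extension_of_card_eq (𝕜 := ℝ)
    (ι := Fin (m + 1)) (by simpa using hV) (v := fun _ => (⟨u, hu⟩ : Vᗮ)) (s := {0})
    ⟨fun _ => by simpa using hu₁, fun i j hij => (hij (Subsingleton.elim _ _)).elim⟩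
  have hc₀ : c 0 = ⟨u, hu⟩ := hc 0 rfl
  have hon : Orthonormal ℝ (fun i => (c i : E)) :=
    c.orthonormal.comp_linearIsometry Vᗮ.subtypeₗᵢ
  obtain ⟨b, hb⟩ := Orthonormal.exists_orthonormalBasis_extension_of_card_eq (𝕜 := ℝ) (E := E)
    (ι := Fin (m + 1) ⊕ Fin (Module.finrank ℝ V))
    (by simp [← hV, ← Submodule.finrank_add_finrank_orthogonal V, add_comm])
    (v := Sum.elim (fun i => (c i : E)) 0) (s := Set.range Sum.inl) (by
      refine ⟨?_, ?_⟩
      · rintro ⟨_, i, rfl⟩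
        simpa using hon.1 i
      · rintro ⟨_, i, rfl⟩ ⟨_, j, rfl⟩ hij
        exact hon.2 fun h => hij (by rw [h]))
  have hb' : ∀ i, b (Sum.inl i) = c i := fun i => hb _ ⟨i, rfl⟩
  refine ⟨b, by rw [hb', hc₀], fun z => ?_⟩
  have hmem : z - V.starProjection z ∈ Vᗮ := Submodule.sub_starProjection_mem_orthogonal z
  have h := c.sum_sq_inner_right ⟨_, hmem⟩
  rw [Submodule.coe_norm] at h
  rw [← h]
  refine Finset.sum_congr rfl fun i _ => ?_
  rw [Submodule.coe_inner, hb', inner_sub_right,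
    Submodule.inner_left_of_mem_orthogonal (Submodule.starProjection_apply_mem V z) (c i).2,
    sub_zero]

variable [MeasurableSpace E] [BorelSpace E]

lemma map_inner_stdGaussian {ι : Type*} [Fintype ι] (b : OrthonormalBasis ι ℝ E) :
    (stdGaussian E).map (fun z i => inner ℝ (b i) z) =
      Measure.pi fun _ : ι => gaussianReal 0 1 := by
  rw [stdGaussian_eq_map_pi_orthonormalBasis b, Measure.map_map (by fun_prop) (by fun_prop)]
  have : (fun (z : E) i => inner ℝ (b i) z) ∘ (fun x : ι → ℝ => ∑ i, x i • b i) = id := by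
    ext x i
    simp [b.orthonormal.inner_right_fintype]
  rw [this, Measure.map_id]

/-- The squared ratio of the residuals after and before projecting out one more fixed direction
has a beta distribution. -/
theorem map_residual_ratio_stdGaussian {V : Submodule ℝ E} {m : ℕ} (hm : m ≠ 0)
    (hV : Module.finrank ℝ Vᗮ = m + 1) {u : E} (hu : u ∈ Vᗮ) (hu₁ : ‖u‖ = 1) :
    (stdGaussian E).map (fun z => (‖z - V.starProjection z‖ ^ 2 - inner ℝ u z ^ 2) /
      ‖z - V.starProjection z‖ ^ 2) = betaMeasure (m / 2) (1 / 2) := by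
  obtain ⟨b, hb₀, hb⟩ := exists_orthonormalBasis_orthogonal hV hu hu₁
  set ι := Fin (m + 1) ⊕ Fin (Module.finrank ℝ V)
  let P : Measure (ι → ℝ) := Measure.pi fun _ => gaussianReal 0 1
  have hind : iIndepFun (fun (i : ι) (x : ι → ℝ) => x i ^ 2) P :=
    iIndepFun_pi (X := fun _ (t : ℝ) => t ^ 2) fun _ => by fun_prop
  have hlaw : ∀ i : ι, P.map (fun x => x i ^ 2) = gammaMeasure (1 / 2) (1 / 2) := fun i => by
    rw [← map_sq_gaussianReal,
      ← (measurePreserving_eval (fun _ : ι => gaussianReal 0 1) i).map_eq,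
      Measure.map_map (by fun_prop) (by fun_prop)]
    rfl
  -- These are the `m` coordinates of `Vᗮ` other than `u`; their squares sum to the numerator.
  let s : Finset ι := Finset.univ.map ((Fin.succEmb m).trans Function.Embedding.inl)
  have hs : s.Nonempty := by
    have : NeZero m := ⟨hm⟩
    exact Finset.univ_nonempty.map
  have h := map_sum_sq_div_eq_betaMeasure (by fun_prop) hind hlaw hs (i := Sum.inl 0) (by
    simp only [s, Finset.mem_map, Finset.mem_univ, true_and, not_exists]
    exact fun x hx => Fin.succ_ne_zero x (Sum.inl_injective hx))
  have hcard : s.card = m := by simp [s]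
  rw [hcard, show P = _ from (map_inner_stdGaussian b).symm, Measure.map_map (by fun_prop) (by fun_prop)] at h
  rw [← h]
  congr 1
  ext z
  simp [hb, s, Fin.sum_univ_succ, hb₀, add_comm]
  rfl

lemma stdGaussian_inner_eq_zero {u : E} (hu₁ : ‖u‖ = 1) :
    stdGaussian E {z | inner ℝ u z = 0} = 0 := by
  have hm : (stdGaussian E).map (fun z => inner ℝ u z) = gaussianReal 0 1 := by
    have h := IsGaussian.map_eq_gaussianReal (μ := stdGaussian E) (innerSL ℝ u)
    rw [integral_strongDual_stdGaussian, variance_dual_stdGaussian] at h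
    simpa [hu₁] using h
  have := nullSingletonClass_gaussianReal (μ := 0) (v := 1) one_ne_zero
  have h := measure_singleton (μ := gaussianReal 0 1) (0 : ℝ)
  rwa [← hm, Measure.map_apply (by fun_prop) (measurableSet_singleton 0)] at h

/-- The beta quantile function is a right inverse of the distribution function, up to an
inequality. -/
lemma le_betaMeasure_Iio_betaInvCDF {a b t : ℝ} (ha : 0 < a) (hb : 0 < b) (ht₀ : 0 < t)
    (ht₁ : t < 1) : t ≤ (betaMeasure a b).real (Set.Iio (betaInvCDF a b t)) := by
  have := isProbabilityMeasureBeta ha hb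
  have hac : betaMeasure a b ≪ volume := withDensity_absolutelyContinuous _ _
  set A := {x : ℝ | t ≤ cdf (betaMeasure a b) x} with hA
  have hne : A.Nonempty := ((tendsto_cdf_atTop (betaMeasure a b)).eventually
    (eventually_ge_nhds ht₁)).exists
  have hbdd : BddBelow A := by
    obtain ⟨x, hx⟩ := ((tendsto_cdf_atBot (betaMeasure a b)).eventually
      (eventually_lt_nhds ht₀)).exists
    exact ⟨x, fun y hy => le_of_not_gt fun hyx =>
      absurd (hy.trans (monotone_cdf _ hyx.le)) (not_le.2 hx)⟩
  have hq : t ≤ cdf (betaMeasure a b) (sInf A) := by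
    -- Right continuity shows that the infimum defining the quantile is attained.
    refine ge_of_tendsto (((cdf (betaMeasure a b)).right_continuous (sInf A)).mono
      Set.Ioi_subset_Ici_self) (eventually_nhdsWithin_of_forall fun y hy => ?_)
    obtain ⟨x, hx, hxy⟩ := exists_lt_of_csInf_lt hne hy
    exact hx.trans (monotone_cdf _ hxy.le)
  rw [cdf_eq_real] at hq
  refine hq.trans_eq ?_
  -- There are no atoms, so the strict inequality of the selection rule costs no probability.
  exact measureReal_congr (hac.ae_eq Iio_ae_eq_Iic.symm)

end Distributions

end RRT

namespace RRT

/-! ### The small-noise limit -/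

section Consistency

variable {n p : ℕ} {X : Matrix (Fin n) (Fin p) ℝ}
  {pick : Finset (Fin p) → Finset (Fin p) → Fin p}

/-- This places all noise levels on one probability space, so that `v → 0` can be studied for fixed
`z`. -/
lemma noise_eq_map_smul_stdGaussian (n : ℕ) {v : ℝ} (hv : 0 ≤ v) :
    noise n v = (stdGaussian (EuclideanSpace ℝ (Fin n))).map (fun z => √v • z) := by
  have hS : (v • (1 : Matrix (Fin n) (Fin n) ℝ)).PosSemidef := Matrix.PosSemidef.one.smul hv
  have : IsProbabilityMeasure ((stdGaussian (EuclideanSpace ℝ (Fin n))).map (fun z => √v • z)) :=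
    Measure.isProbabilityMeasure_map (by fun_prop)
  unfold noise
  refine Measure.ext_of_charFun ?_
  ext t
  rw [charFun_multivariateGaussian hS, charFun_map_smul, charFun_stdGaussian, ← Complex.ofReal_pow,
    norm_smul, mul_pow, Real.norm_eq_abs, sq_abs, Real.sq_sqrt hv, inner_zero_right]
  congr 1
  have : t.ofLp ⬝ᵥ t.ofLp = ‖t‖ ^ 2 := by
    rw [EuclideanSpace.real_norm_sq_eq]
    simp [dotProduct, sq]
  rw [Matrix.smul_mulVec, Matrix.one_mulVec, dotProduct_smul, this]
  push_cast [smul_eq_mul]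
  ring

/-- The event that a fixed direction reduces the residual of pure noise by a ratio below the
threshold has at least the nominal probability. -/
lemma le_stdGaussian_ratio_lt {S : Finset (Fin p)} (hrank : Module.finrank ℝ (colSpan X S) = S.card)
    {j : Fin p} (hj : colVec X j ∉ colSpan X S) {kmax : ℕ} (hkmax : S.card < kmax)
    (hkn : kmax < n) (hSp : S.card < p) {α : ℝ} (hα₀ : 0 < α) (hα₁ : α < 1) :
    α / (kmax * ((p : ℝ) - S.card)) ≤ (stdGaussian (EuclideanSpace ℝ (Fin n))).real
      {z | inner ℝ (colVec X j) (residual X S z) ≠ 0 ∧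
        √((‖residual X S z‖ ^ 2 - inner ℝ (colVec X j) (residual X S z) ^ 2 /
          ‖residual X S (colVec X j)‖ ^ 2) / ‖residual X S z‖ ^ 2) <
            rrtThreshold n p kmax α (S.card + 1)} := by
  -- The complement of the span of `S` has dimension `m + 1`, and `m / 2` is the first beta
  -- parameter in `Γ(k₀ + 1)`; `k₀ < kmax < n` gives `m ≠ 0`.
  obtain ⟨m, hm⟩ : ∃ m, n = S.card + m + 1 := ⟨n - S.card - 1, by omega⟩
  have hm0 : m ≠ 0 := by omega
  set h := residual X S (colVec X j) with hh
  have hne : h ≠ 0 := fun h0 => hj (by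
    rw [sub_eq_zero.1 h0]
    exact Submodule.starProjection_apply_mem _ _)
  have hpos : 0 < ‖h‖ := norm_pos_iff.2 hne
  set u := ‖h‖⁻¹ • h with hu
  have hu₁ : ‖u‖ = 1 := by rw [hu, norm_smul, norm_inv, norm_norm, inv_mul_cancel₀ hpos.ne']
  have huV : u ∈ (colSpan X S)ᗮ :=
    Submodule.smul_mem _ _ (residual_mem_orthogonal X S (colVec X j))
  have hproj : ∀ z, inner ℝ u (residual X S z) = inner ℝ u z := fun z => by
    rw [residual, inner_sub_right, Submodule.inner_left_of_mem_orthogonal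
      (Submodule.starProjection_apply_mem (colSpan X S) z) huV, sub_zero]
  have hinner : ∀ z, inner ℝ (colVec X j) (residual X S z) = ‖h‖ * inner ℝ u z := fun z => by
    rw [← hproj, ← inner_residual_left, ← hh, hu, inner_smul_left, conj_trivial,
      mul_inv_cancel_left₀ hpos.ne']
  have hV : Module.finrank ℝ (colSpan X S)ᗮ = m + 1 := by
    have := Submodule.finrank_add_finrank_orthogonal (colSpan X S)
    rw [hrank, finrank_euclideanSpace_fin] at this
    omega
  have hSp' : (1 : ℝ) ≤ (p : ℝ) - S.card := by
    have : (S.card : ℝ) + 1 ≤ p := by exact_mod_cast hSp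
    linarith
  have hk1 : (1 : ℝ) ≤ kmax := by
    have : 1 ≤ kmax := by omega
    exact_mod_cast this
  have hden : 1 ≤ kmax * ((p : ℝ) - S.card) := one_le_mul_of_one_le_of_one_le hk1 hSp'
  set q := betaInvCDF (m / 2) (1 / 2) (α / (kmax * ((p : ℝ) - S.card))) with hq
  have hthr : rrtThreshold n p kmax α (S.card + 1) = √q := by
    rw [rrtThreshold, hq, hm]
    push_cast
    congr 2
    · ring
    · ring
  have hmain := le_betaMeasure_Iio_betaInvCDF (a := m / 2) (b := 1 / 2)
    (t := α / (kmax * ((p : ℝ) - S.card))) (by positivity) (by norm_num)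
    (div_pos hα₀ (by linarith)) ((div_lt_one (by linarith)).2 (by linarith))
  refine hmain.trans ?_
  have hmeas : Measurable fun z : EuclideanSpace ℝ (Fin n) =>
      (‖z - (colSpan X S).starProjection z‖ ^ 2 - inner ℝ u z ^ 2) /
        ‖z - (colSpan X S).starProjection z‖ ^ 2 := by fun_prop
  rw [← hq, ← map_residual_ratio_stdGaussian hm0 hV huV hu₁, measureReal_def,
    Measure.map_apply hmeas measurableSet_Iio, measureReal_def]
  refine ENNReal.toReal_mono (measure_ne_top _ _) (measure_mono_ae ?_)
  have hae : ∀ᵐ z ∂stdGaussian (EuclideanSpace ℝ (Fin n)), inner ℝ u z ≠ 0 := by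
    rw [ae_iff]
    simpa using stdGaussian_inner_eq_zero hu₁
  filter_upwards [hae] with z hz hlt
  refine ⟨by rw [hinner]; exact mul_ne_zero hpos.ne' hz, ?_⟩
  have hdiv : (‖h‖ * inner ℝ u z) ^ 2 / ‖h‖ ^ 2 = inner ℝ u z ^ 2 := by
    rw [mul_pow, mul_div_cancel_left₀ _ (pow_ne_zero 2 hpos.ne')]
  rw [hthr, hinner, hdiv]
  refine Real.sqrt_lt_sqrt (div_nonneg (sub_nonneg.2 ?_) (sq_nonneg _)) hlt
  rw [← hproj]
  refine sq_le_sq.2 ((abs_real_inner_le_norm _ _).trans ?_)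
  rw [hu₁, one_mul, abs_norm]

/-- If small noise does not prevent orthogonal matching pursuit from recovering the support, then
the probability of overestimation converges to a limit that is at least the nominal level. -/
theorem exists_tendsto_noise_ssubset_rrtSupport
    (hpick : ∀ J A : Finset (Fin p), A.Nonempty → pick J A ∈ A) {β : EuclideanSpace ℝ (Fin p)}
    {kmax : ℕ} (hkmax : (supp β).card < kmax) (hkn : kmax < n) (hkp : kmax ≤ p)
    {α : ℝ} (hα₀ : 0 < α) (hα₁ : α < 1) (hX : Dominates X (supp β))
    (hX' : ∀ j ∉ supp β, colVec X j ∉ colSpan X (supp β)) :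
    ∃ L : ℝ, Tendsto (fun v : ℝ => (noise n v).real
        {w | supp β ⊂ rrtSupport X pick kmax α (apply X β + w)}) (𝓝[>] 0) (𝓝 L) ∧
      α / (kmax * ((p : ℝ) - (supp β).card)) ≤ L := by
  set S := supp β with hS
  have hSp : S.card < p := by omega
  obtain ⟨j₀, hj₀⟩ : ∃ j₀, j₀ ∉ S := by
    by_contra! hall
    rw [Finset.eq_univ_of_forall hall, Finset.card_univ, Fintype.card_fin] at hSp
    omega
  have : Nonempty (Fin p) := ⟨j₀⟩
  -- This choice depends on `X` and `S` only, so the direction is not random.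
  obtain ⟨j, hj⟩ := Finite.exists_max fun t => ‖residual X S (colVec X t)‖
  have hjV : colVec X j ∉ colSpan X S := fun h => by
    have h1 := hj j₀
    rw [residual_eq_zero h, norm_zero, norm_le_zero_iff, residual, sub_eq_zero] at h1
    refine hX' j₀ hj₀ ?_
    rw [h1]
    exact Submodule.starProjection_apply_mem _ _
  set P := stdGaussian (EuclideanSpace ℝ (Fin n))
  set U : Set (EuclideanSpace ℝ (Fin n)) := {w | S ⊂ rrtSupport X pick kmax α (apply X β + w)}
  have hU : MeasurableSet U :=
    (measurable_const_add (apply X β)) (measurableSet_ssubset_rrtSupport S kmax α)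
  have homp : ∀ z : EuclideanSpace ℝ (Fin n), ∀ᶠ v in 𝓝[>] (0 : ℝ),
      0 < √v ∧ ompSupport X pick (apply X β + √v • z) S.card = S := by
    intro z
    have hlim : Tendsto (fun v : ℝ => √v • z) (𝓝[>] 0) (𝓝 0) := by
      have : Continuous fun v : ℝ => √v • z := by fun_prop
      simpa using (this.tendsto 0).mono_left nhdsWithin_le_nhds
    filter_upwards [hlim.eventually (eventually_maximizers_subset hS.symm hX hj₀),
      self_mem_nhdsWithin] with v hv hpos
    exact ⟨Real.sqrt_pos.2 hpos, ompSupport_card_eq hpick hv⟩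
  -- The limit event: the noise directions that lead to overestimation for all small `v`.
  set L : Set (EuclideanSpace ℝ (Fin n)) := {z | ∀ᶠ v in 𝓝[>] (0 : ℝ), √v • z ∈ U}
  have hconst : ∀ z, ∀ᶠ v in 𝓝[>] (0 : ℝ), z ∈ (fun z => √v • z) ⁻¹' U ↔ z ∈ L := by
    intro z
    have hpair : ∀ v v' : ℝ, 0 < √v ∧ ompSupport X pick (apply X β + √v • z) S.card = S →
        0 < √v' ∧ ompSupport X pick (apply X β + √v' • z) S.card = S →
        (√v • z ∈ U ↔ √v' • z ∈ U) := by
      intro v v' hv hv'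
      refine ssubset_rrtSupport_iff_of_residual_eq_smul hv.2 hv'.2 (div_pos hv'.1 hv.1)
        fun J hJ => ?_
      rw [residual_apply_add hJ, residual_apply_add hJ, residual_smul, residual_smul, smul_smul,
        div_mul_cancel₀ _ hv.1.ne']
    filter_upwards [homp z] with v hv
    constructor
    · intro hvU
      filter_upwards [homp z] with v' hv'
      exact (hpair v v' hv hv').1 hvU
    · intro hL
      obtain ⟨v', hv', hv'U⟩ := ((homp z).and hL).exists
      exact (hpair v' v hv' hv).1 hv'U
  have hlim := tendsto_measure_of_tendsto_indicator_of_isFiniteMeasure (A := L) (𝓝[>] (0 : ℝ)) P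
    (As := fun v => (fun z => √v • z) ⁻¹' U) (fun v => (measurable_const_smul (√v)) hU) hconst
  refine ⟨P.real L, ?_, ?_⟩
  · refine ((ENNReal.tendsto_toReal (measure_ne_top P L)).comp hlim).congr' ?_
    filter_upwards [self_mem_nhdsWithin] with v hv
    rw [noise_eq_map_smul_stdGaussian n (le_of_lt hv), measureReal_def,
      Measure.map_apply (measurable_const_smul _) hU]
    rfl
  · refine (le_stdGaussian_ratio_lt (finrank_colSpan hX hj₀) hjV hkmax hkn hSp hα₀ hα₁).trans ?_
    refine measureReal_mono fun z hz => ?_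
    filter_upwards [homp z] with v hv
    have hr : residual X S (apply X β + √v • z) = √v • residual X S z := by
      rw [residual_apply_add hS.symm.le, residual_smul]
    refine ssubset_rrtSupport_of_ratio_lt hpick hv.2 hkmax hj ?_ ?_
    · rw [hr, inner_smul_right]
      exact mul_ne_zero hv.1.ne' hz.1
    · refine lt_of_eq_of_lt ?_ hz.2
      rw [hr, inner_smul_right, norm_smul, Real.norm_eq_abs, abs_of_pos hv.1, mul_pow, mul_pow,
        mul_div_assoc, ← mul_sub, mul_div_mul_left _ _ (pow_ne_zero 2 hv.1.ne')]

lemma not_highSNRConsistent_of_tendsto {β : EuclideanSpace ℝ (Fin p)}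
    {est : EuclideanSpace ℝ (Fin n) → Finset (Fin p)} {L : ℝ} (hL : 0 < L)
    (h : Tendsto (fun v : ℝ => (noise n v).real {w | supp β ⊂ est (apply X β + w)})
      (𝓝[>] 0) (𝓝 L)) : ¬ HighSNRConsistent X β est := by
  intro hcons
  refine absurd (le_of_tendsto_of_tendsto' h hcons fun v => ?_) (not_le.2 hL)
  have : IsProbabilityMeasure (noise n v) := by
    unfold noise
    infer_instance
  exact measureReal_mono fun w hw => hw.ne'

end Consistency

end RRT

theorem lemma4 {n p : ℕ} (X : Matrix (Fin n) (Fin p) ℝ) (β : EuclideanSpace ℝ (Fin p))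
    (pick : Finset (Fin p) → Finset (Fin p) → Fin p)
    (hpick : ∀ J A : Finset (Fin p), A.Nonempty → pick J A ∈ A)
    (k₀ kmax : ℕ) (hk₀ : (RRT.supp β).card = k₀)
    (hkmax : k₀ < kmax) (hkn : kmax < n) (hkp : kmax ≤ p)
    (α : ℝ) (hα₀ : 0 < α) (hα₁ : α < 1)
    (hX : RRT.ric X (k₀ + 1) < 1 / Real.sqrt ((k₀ : ℝ) + 1) ∨
      (RRT.UnitColumns X ∧ RRT.coherence X < 1 / (2 * (k₀ : ℝ) - 1)) ∨
      (RRT.UnitColumns X ∧ RRT.ExactRecovery X (RRT.supp β))) :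
    (∃ L : ℝ,
      Tendsto (fun v : ℝ => (RRT.noise n v).real
          {w | RRT.supp β ⊂ RRT.rrtSupport X pick kmax α (RRT.apply X β + w)})
        (𝓝[>] 0) (𝓝 L) ∧
      α / (kmax * ((p : ℝ) - k₀)) ≤ L) ∧
    ¬ RRT.HighSNRConsistent X β (RRT.rrtSupport X pick kmax α) := by
  subst hk₀
  have hdom : RRT.Dominates X (RRT.supp β) ∧
      ∀ j ∉ RRT.supp β, RRT.colVec X j ∉ RRT.colSpan X (RRT.supp β) := by
    rcases hX with h | ⟨hu, h⟩ | ⟨hu, h⟩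
    · exact RRT.dominates_of_ric h
    · exact RRT.dominates_of_coherence hu h
    · exact RRT.dominates_of_exactRecovery hu h
  obtain ⟨L, hL, hle⟩ := RRT.exists_tendsto_noise_ssubset_rrtSupport hpick hkmax hkn hkp hα₀ hα₁
    hdom.1 hdom.2
  refine ⟨⟨L, hL, hle⟩, RRT.not_highSNRConsistent_of_tendsto (lt_of_lt_of_le ?_ hle) hL⟩
  have h1 : (0 : ℝ) < kmax := by exact_mod_cast (Nat.zero_le _).trans_lt hkmax
  have h2 : (0 : ℝ) < p - (RRT.supp β).card :=
    sub_pos.2 (by exact_mod_cast hkmax.trans_le hkp)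
  positivity
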